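/- Let $\mathbb{K}$ be an algebraically closed, trivially valued field. **Conventions.** For $Z\subset(\mathbb{K}^*)^n$ let $I(Z)\subset\mathbb{K}[x_1^{\pm1},\dots,x_n^{\pm1}]$ be its ideal. For $w\in\mathbb{R}^n$, $\mathrm{in}_w(f)$ is the sum of the terms of $f$ of minimal $w$-weight and $\mathrm{in}_w(I)=\langle \mathrm{in}_w(f): f\in I\rangle$. Set $\mathrm{trop}(Z)=\{w\in\mathbb{R}^n:\ \mathrm{in}_w(I(Z))\text{ contains no monomial}\}$. A *tropical basis* for $Z$ is a subset $G\subset I(Z)$ with $\mathrm{trop}(Z)=\bigcap_{f\in G}\mathrm{trop}(V(f))$. **Setup.** Let $M$ and $N$ be dual lattices of finite rank. Let $\sigma\subset N_\mathbb{Q}$ be a pointed polyhedral cone and let $\Delta_0,\dots,\Delta_m\subset N_{\mathbb{Q}}$ be polyhedra with tailcone $\sigma$ (i.e. sums of a polytope and $\sigma$) or empty, with $\sum_i\Delta_i\subsetneq\sigma$. For $u\in\sigma^\vee$ put $\Delta_i(u)=\min_{x\in\Delta_i}\langle x,u\rangle$ ($=\infty$ if $\Delta_i=\emptyset$). Let $e_1,\dots,e_m$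 be the standard basis of $\mathbb{Q}^m$, let $e_0=-\sum_{i\ge1} e_i$, and let $C\subset N_\mathbb{Q}\times\mathbb{Q}^m$ be the cone generated by all $\Delta_i\times e_i$ and $\sigma\times 0$. Put $A(C)=\mathbb{K}[C^\vee\cap(M\times\mathbb{Z}^m)]\subset\mathbb{K}[M\times\mathbb{Z}^m]$ and $X(C)=\mathrm{Spec}\,A(C)$. Let $L\subset\mathbb{P}^m=\mathrm{Proj}\,\mathbb{K}[y_0,\dots,y_m]$ be a line meeting the dense torus $(\mathbb{K}^*)^m$, which has coordinates $z_i=y_i/y_0$, and let $L^\circ=L\cap(\mathbb{K}^*)^m$ and $I(L)=I(L^\circ)\subset\mathbb{K}[z_1^{\pm1},\dots,z_m^{\pm1}]=\mathbb{K}[\mathbb{Z}^m]$. Let $Q_i$ be the point $L\cap V(y_i)$, taken as the restriction of the divisor $V(y_i)$ to $L$. Put $$A(L)=\bigoplus_{u\in\sigma^\vee\cap M}H^0\Big(L,\mathcal{O}\big(\textstyle\sum_i\lfloor\Delta_i(u)\rfloor Q_i\big)\Big)\chi^u,\qquad X(L)=\mathrm{Spec}\,A(L),$$ where a coefficient $\infty$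 means that poles of any order are allowed. Restriction of sections $z^v\chi^u\mapsto (z^v|_L)\chi^u$ is a map $A(C)\to A(L)$, which embeds $X(L)$ into $X(C)$. Let $\widetilde I(L)\subset A(C)$ be the ideal generated by all $f\chi^u\in A(C)$ with $f\in I(L)$ and $u\in M$. Let $H$ be a finite generating set of the semigroup $C^\vee\cap(M\times\mathbb{Z}^m)$, let $S=\mathbb{K}[x_h: h\in H]$, and let $S\to A(C)$ be the map $x_h\mapsto\chi^h$. Its kernel is the toric ideal of $X(C)\subset\mathbb{A}^{H}$, and the kernel $J(L)$ of the composition $S\to A(C)\to A(L)$ is the ideal of $X(L)\subset\mathbb{A}^H$. Let $X(L)^\circ=X(L)\cap(\mathbb{K}^*)^{H}$. Let $\mathcal{G}(L)$ be a tropical basis for $L^\circ$ whose elements are dehomogenizations $a_0+a_1z_1+\dots+a_mz_m$ of linear forms. Let $P$ be the set of all $(u,v)$ with $u\in\sigma^\vee$, $v_i\ge-\Delta_i(u)$ for $i=1,\dots,m$, and $\sum_{i=1}^m v_i\le\Delta_0(u)-1$. Let $\mathcal{P}\subset P\cap(M\times\mathbb{Z}^m)$ be a set such that every lattice point of $P$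 is the sum of an element of $\mathcal{P}$ and a lattice point of $C^\vee$. A *term-by-term lift* to $S$ of an element of $A(C)$ is a polynomial obtained by replacing each term $c\,\chi^{(u,v)}$ ($c\neq 0$) by one term $c\,x^\alpha$ whose monomial $x^\alpha$ is mapped to $\chi^{(u,v)}$. **Statement.** The toric ideal of $X(C)\subset\mathbb{A}^H$ is generated by binomials. The elements $(gz^v)\chi^u$ with $g\in\mathcal{G}(L)$ and $(u,v)\in\mathcal{P}$ lie in $A(C)$, generate the ideal $\widetilde I(L)$, and have term-by-term lifts to $S$. For every set $B$ of binomials generating the toric ideal and every set $E\subset S$ consisting of term-by-term lifts of these elements, at least one for each of them, the set $B\cup E$ generates the ideal $J(L)$ and is a tropical basis for $X(L)^\circ$. -/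

import Mathlib

open scoped Polynomial WithZero

noncomputable section

namespace SemiCanonical

/-! ### Tropical geometry in the torus `(Kˣ)^ι` with trivial valuation -/

section Tropical

variable (K : Type*) [Field K] (ι : Type*) [Fintype ι]

/-- The ring `K[x_i^{±1} | i ∈ ι]` of Laurent polynomials. -/
abbrev Laurent : Type _ := AddMonoidAlgebra K (ι → ℤ)

variable {K ι}

/-- Evaluation of Laurent polynomials at a point of the torus. -/
def evalTorus (x : ι → Kˣ) : Laurent K ι →ₐ[K] K :=
  AddMonoidAlgebra.lift K K (ι → ℤ)
    { toFun := fun α => ((∏ i, x i ^ (α.toAdd i) : Kˣ) : K)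
      map_one' := by simp
      map_mul' := fun α β => by simp [zpow_add, Finset.prod_mul_distrib] }

/-- The ideal `I(Z)` of all Laurent polynomials vanishing on `Z ⊆ (Kˣ)^ι`. -/
def torusIdeal (Z : Set (ι → Kˣ)) : Ideal (Laurent K ι) :=
  ⨅ x ∈ Z, RingHom.ker (evalTorus x)

/-- The hypersurface `V(f) ⊆ (Kˣ)^ι`. -/
def hypersurface (f : Laurent K ι) : Set (ι → Kˣ) := {x | evalTorus x f = 0}

/-- The weight `α · w`. -/
def weight (w : ι → ℝ) (α : ι → ℤ) : ℝ := ∑ i, (α i : ℝ) * w i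

open Classical in
/-- The initial form `in_w f`: the sum of the terms of `f` of minimal `w`-weight. -/
def initialForm (w : ι → ℝ) (f : Laurent K ι) : Laurent K ι :=
  AddMonoidAlgebra.ofCoeff
    (f.coeff.filter fun α => ∀ β ∈ f.coeff.support, weight w α ≤ weight w β)

/-- The initial ideal `in_w I`, generated by the initial forms of all elements of `I`. -/
def initialIdeal (w : ι → ℝ) (I : Ideal (Laurent K ι)) : Ideal (Laurent K ι) :=
  Ideal.span (initialForm w '' (I : Set (Laurent K ι)))

/-- The tropicalization of `Z`: all `w` such that `in_w (I(Z))` contains no monomial. -/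
def trop (Z : Set (ι → Kˣ)) : Set (ι → ℝ) :=
  {w | ∀ α : ι → ℤ, AddMonoidAlgebra.single α (1 : K) ∉ initialIdeal w (torusIdeal Z)}

/-- A tropical basis of `Z`: a subset `G` of `I(Z)` such that `trop Z` is the intersection of the
tropical hypersurfaces `trop (V(f))`, `f ∈ G`. -/
def IsTropicalBasis (Z : Set (ι → Kˣ)) (G : Set (Laurent K ι)) : Prop :=
  G ⊆ torusIdeal Z ∧ trop Z = ⋂ f ∈ G, trop (hypersurface f)

end Tropical

/-! ### Polyhedral data and the cone `C` -/

/-- Elements of `M × ℤ^m`, where `M = ℤ^r` is the character lattice of the torus `T`. -/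
abbrev Char (r m : ℕ) : Type := (Fin r → ℤ) × (Fin m → ℤ)

/-- The pairing of `u ∈ M` with `x ∈ N_ℚ`. -/
def pair {r : ℕ} (u : Fin r → ℤ) (x : Fin r → ℚ) : ℚ := ∑ k, (u k : ℚ) * x k

/-- The pairing of `M × ℤ^m` with `N_ℚ × ℚ^m`. -/
def bigPair {r m : ℕ} (c : Char r m) (x : (Fin r → ℚ) × (Fin m → ℚ)) : ℚ :=
  pair c.1 x.1 + pair c.2 x.2

/-- `e_1, …, e_m` is the standard basis of `ℚ^m`, and `e_0 = -(e_1 + ⋯ + e_m)`. -/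
def eVec {m : ℕ} : Fin (m + 1) → (Fin m → ℚ) :=
  Fin.cons (fun _ => -1) (fun j => Pi.single j 1)

open scoped Pointwise in
/-- The coefficients `Δ_0, …, Δ_m` of a polyhedral divisor on `ℙ¹` with tailcone `σ ⊆ N_ℚ`, where
`N = ℤ^r`. A polyhedron with tailcone `σ` is a Minkowski sum of a polytope and `σ`; an empty
vertex set gives the permitted coefficient `∅`. -/
structure PolyhedralData (r m : ℕ) where
  /-- the tailcone -/
  σ : PointedCone ℚ (Fin r → ℚ)
  /-- `σ` is polyhedral -/
  σ_fg : σ.FG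
  /-- `σ` contains no line -/
  σ_pointed : ∀ x ∈ σ, -x ∈ σ → x = 0
  /-- the polyhedra -/
  Δ : Fin (m + 1) → Set (Fin r → ℚ)
  Δ_polyhedron : ∀ i, ∃ V : Finset (Fin r → ℚ),
    Δ i = convexHull ℚ (V : Set (Fin r → ℚ)) + (σ : Set (Fin r → ℚ))
  /-- the Minkowski sum of the `Δ_i` is properly contained in `σ` -/
  proper : {x | ∃ y : Fin (m + 1) → (Fin r → ℚ), (∀ i, y i ∈ Δ i) ∧ x = ∑ i, y i} ⊂
    (σ : Set (Fin r → ℚ))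

namespace PolyhedralData

variable {r m : ℕ} (D : PolyhedralData r m)

/-- `u` lies in the dual cone `σ^∨`. -/
def InDual (u : Fin r → ℤ) : Prop := ∀ x ∈ D.σ, 0 ≤ pair u x

/-- The cone `C ⊆ N_ℚ × ℚ^m` generated by the `Δ_i × e_i` and by `σ × 0`. -/
def C : PointedCone ℚ ((Fin r → ℚ) × (Fin m → ℚ)) :=
  PointedCone.hull ℚ ((⋃ i, D.Δ i ×ˢ {eVec i}) ∪ (D.σ : Set (Fin r → ℚ)) ×ˢ {0})

/-- The semigroup `C^∨ ∩ (M × ℤ^m)`. -/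
def dualMonoid : AddSubmonoid (Char r m) where
  carrier := {c | ∀ x ∈ D.C, 0 ≤ bigPair c x}
  zero_mem' := by
    intro x _
    simp [bigPair, pair]
  add_mem' := by
    intro a b ha hb x hx
    have h : bigPair (a + b) x = bigPair a x + bigPair b x := by
      simp only [bigPair, pair, Prod.fst_add, Prod.snd_add, Pi.add_apply, Int.cast_add, add_mul,
        Finset.sum_add_distrib]
      ring
    rw [h]
    exact add_nonneg (ha x hx) (hb x hx)

open Classical in
/-- `Δ_i(u) = min {⟨u, x⟩ | x ∈ Δ_i}` for `u ∈ σ^∨`, which is `∞` if `Δ_i = ∅`. -/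
def minVal (i : Fin (m + 1)) (u : Fin r → ℤ) : WithTop ℝ :=
  if (D.Δ i).Nonempty then ((sInf ((fun x => ((pair u x : ℚ) : ℝ)) '' D.Δ i) : ℝ) : WithTop ℝ)
  else ⊤

/-- `⌊Δ_i(u)⌋ ∈ ℤ ∪ {∞}`. -/
def floorVal (i : Fin (m + 1)) (u : Fin r → ℤ) : WithTop ℤ := (D.minVal i u).map Int.floor

/-- The lattice points `(u, v)` of the polyhedron `P`, given by `u ∈ σ^∨`,
`v_i ≥ -Δ_i(u)` for `i > 0`, and `v_1 + ⋯ + v_m ≤ Δ_0(u) - 1`. -/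
def latticeP : Set (Char r m) :=
  {c | D.InDual c.1 ∧ (∀ j : Fin m, (((-c.2 j : ℤ) : ℝ) : WithTop ℝ) ≤ D.minVal j.succ c.1) ∧
    (((∑ j, c.2 j + 1 : ℤ) : ℝ) : WithTop ℝ) ≤ D.minVal 0 c.1}

/-- `Q` is a set of lattice generators of `P` as a `C^∨`-module. -/
def IsLatticeGenerators (Q : Set (Char r m)) : Prop :=
  Q ⊆ D.latticeP ∧ ∀ p ∈ D.latticeP, ∃ q ∈ Q, ∃ c ∈ D.dualMonoid, p = q + c

theorem bddBelow_pair (i : Fin (m + 1)) {u : Fin r → ℤ} (hu : D.InDual u) :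
    BddBelow ((fun x => ((pair u x : ℚ) : ℝ)) '' D.Δ i) := by
  obtain ⟨V, hV⟩ := D.Δ_polyhedron i
  obtain ⟨b, hb⟩ := (V.image (pair u)).bddBelow
  refine ⟨(b : ℝ), ?_⟩
  rintro _ ⟨x, hx, rfl⟩
  rw [hV] at hx
  obtain ⟨y, hy, s, hs, rfl⟩ := hx
  have hlin : IsLinearMap ℚ (pair u) :=
    ⟨fun a c => by simp [pair, mul_add, Finset.sum_add_distrib],
     fun a c => by simp [pair, Finset.mul_sum, mul_left_comm]⟩
  have h1 : y ∈ {z | b ≤ pair u z} :=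
    convexHull_min (fun z hz => hb (by
      simp only [Finset.coe_image]; exact ⟨z, hz, rfl⟩)) (convex_halfSpace_ge hlin b) hy
  have h2 := hu s hs
  have h3 : pair u (y + s) = pair u y + pair u s := hlin.map_add y s
  have h4 : b ≤ pair u y := h1
  have h5 : b ≤ pair u (y + s) := by rw [h3]; linarith
  change (b : ℝ) ≤ ((pair u (y + s) : ℚ) : ℝ)
  exact_mod_cast h5

theorem floorVal_add (i : Fin (m + 1)) {u u' : Fin r → ℤ} (hu : D.InDual u)
    (hu' : D.InDual u') : D.floorVal i u + D.floorVal i u' ≤ D.floorVal i (u + u') := by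
  unfold floorVal minVal
  by_cases h : (D.Δ i).Nonempty
  · simp only [h, if_true, WithTop.map_coe]
    norm_cast
    refine (Int.le_floor_add _ _).trans (Int.floor_le_floor ?_)
    refine le_csInf (h.image _) ?_
    rintro _ ⟨x, hx, rfl⟩
    have h1 := csInf_le (D.bddBelow_pair i hu) ⟨x, hx, rfl⟩
    have h2 := csInf_le (D.bddBelow_pair i hu') ⟨x, hx, rfl⟩
    have h3 : pair (u + u') x = pair u x + pair u' x := by
      simp [pair, add_mul, Finset.sum_add_distrib]
    simp only [h3]
    push_cast
    exact add_le_add h1 h2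
  · simp [h]

theorem floorVal_zero (i : Fin (m + 1)) : 0 ≤ D.floorVal i 0 := by
  unfold floorVal minVal
  by_cases h : (D.Δ i).Nonempty
  · simp [h, pair]
  · simp [h]

theorem inDual_add {u u' : Fin r → ℤ} (hu : D.InDual u) (hu' : D.InDual u') :
    D.InDual (u + u') := by
  intro x hx
  have h3 : pair (u + u') x = pair u x + pair u' x := by
    simp [pair, add_mul, Finset.sum_add_distrib]
  rw [h3]
  exact add_nonneg (hu x hx) (hu' x hx)

theorem inDual_of_mem {c : Char r m} (hc : c ∈ D.dualMonoid) : D.InDual c.1 := by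
  intro x hx
  have := hc (x, 0) (Submodule.subset_span (Or.inr ⟨hx, rfl⟩))
  simpa [bigPair, pair] using this

/-- `(v_0, v_1, …, v_m)` with `v_0 = -(v_1 + ⋯ + v_m)`. -/
def extend (v : Fin m → ℤ) : Fin (m + 1) → ℤ := Fin.cons (-∑ j, v j) v

theorem neg_extend_le_floorVal {c : Char r m} (hc : c ∈ D.dualMonoid) (i : Fin (m + 1)) :
    ((-extend c.2 i : ℤ) : WithTop ℤ) ≤ D.floorVal i c.1 := by
  unfold floorVal minVal
  by_cases h : (D.Δ i).Nonempty
  · simp only [h, if_true, WithTop.map_coe]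
    rw [WithTop.coe_le_coe, Int.le_floor]
    refine le_csInf (h.image _) ?_
    rintro _ ⟨x, hx, rfl⟩
    have h1 := hc (x, eVec i)
      (Submodule.subset_span (Or.inl (Set.mem_iUnion.2 ⟨i, hx, rfl⟩)))
    have h2 : pair c.2 (eVec i) = (extend c.2 i : ℤ) := by
      refine Fin.cases ?_ (fun j => ?_) i
      · simp [pair, eVec, extend]
      · simp [pair, eVec, extend, Pi.single_apply]
    rw [bigPair, h2] at h1
    have h3 : ((-extend c.2 i : ℤ) : ℚ) ≤ pair c.1 x := by push_cast; linarith
    change ((-extend c.2 i : ℤ) : ℝ) ≤ ((pair c.1 x : ℚ) : ℝ)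
    exact_mod_cast h3
  · simp [h]

end PolyhedralData

/-! ### Lines in `ℙ^m`, their sections, and the rings `A(C)` and `A(L)` -/

/-- A line `L ⊆ ℙ^m` meeting the dense torus, given by two points `p ≠ q` on it. -/
structure TorusLine (K : Type*) [Field K] (m : ℕ) where
  /-- a point on the line -/
  p : Fin (m + 1) → K
  /-- a second point on the line -/
  q : Fin (m + 1) → K
  independent : LinearIndependent K ![p, q]
  meets_torus : ∃ y ∈ Submodule.span K {p, q}, ∀ i, y i ≠ 0

namespace TorusLine

variable {K : Type*} [Field K] {r m : ℕ} (L : TorusLine K m)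

/-- `L° = L ∩ (Kˣ)^m`, in the coordinates `z_i = y_i / y_0`, `i = 1, …, m`. -/
def torusPart : Set (Fin m → Kˣ) :=
  {z | (Fin.cons 1 (fun j => (z j : K)) : Fin (m + 1) → K) ∈ Submodule.span K {L.p, L.q}}

/-- The pullback of the coordinate `y_i` to the affine chart `t ↦ p + t q` of `L`. -/
def coord (i : Fin (m + 1)) : K[X] :=
  Polynomial.C (L.p i) + Polynomial.C (L.q i) * Polynomial.X

/-- The closed points of `L ≅ ℙ¹`: those of the chart `t ↦ p + t q`, and the point `q`. -/
abbrev Place (K : Type*) [Field K] : Type _ :=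
  Option (IsDedekindDomain.HeightOneSpectrum K[X])

open Classical in
/-- The valuation of the function field `K(L) = K(t)` at a closed point, written
multiplicatively: it is `exp (-ord_Q f)` for `f ≠ 0`. -/
def placeVal : Place K → Valuation (RatFunc K) ℤᵐ⁰
  | none => RatFunc.inftyValuation K
  | some Q => Q.valuation (RatFunc K)

/-- The point `Q_i`, where `V(y_i)` meets `L`, is equal to `Q`. -/
def MeetsAt (i : Fin (m + 1)) : Place K → Prop
  | none => L.q i = 0
  | some Q => L.coord i ∈ Q.asIdeal

open Classical in
/-- `f ∈ H⁰(L, O(∑ a_i Q_i))`, that is, `ord_Q f + ∑_{Q_i = Q} a_i ≥ 0` at all closed points `Q`;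
where some `a_i` with `Q_i = Q` is infinite, poles of any order are permitted. -/
def IsSection (a : Fin (m + 1) → WithTop ℤ) (f : RatFunc K) : Prop :=
  ∀ (Q : Place K) (d : ℤ), ∑ i with L.MeetsAt i Q, a i = (d : WithTop ℤ) →
    placeVal Q f ≤ WithZero.exp d

theorem isSection_add {a : Fin (m + 1) → WithTop ℤ} {f g : RatFunc K} (hf : L.IsSection a f)
    (hg : L.IsSection a g) : L.IsSection a (f + g) := fun Q d h =>
  (placeVal Q).map_add_le (hf Q d h) (hg Q d h)

theorem isSection_zero (a : Fin (m + 1) → WithTop ℤ) : L.IsSection a 0 := fun Q d _ => by simp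

theorem isSection_mul {a b c : Fin (m + 1) → WithTop ℤ} (habc : ∀ i, a i + b i ≤ c i)
    {f g : RatFunc K} (hf : L.IsSection a f) (hg : L.IsSection b g) :
    L.IsSection c (f * g) := by
  classical
  intro Q d h
  have hle : (∑ i with L.MeetsAt i Q, a i) + (∑ i with L.MeetsAt i Q, b i) ≤ (d : WithTop ℤ) := by
    rw [← h, ← Finset.sum_add_distrib]
    exact Finset.sum_le_sum fun i _ => habc i
  have hne := ne_top_of_le_ne_top WithTop.coe_ne_top hle
  rw [WithTop.add_ne_top] at hne
  obtain ⟨d₁, h₁⟩ := WithTop.ne_top_iff_exists.1 hne.1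
  obtain ⟨d₂, h₂⟩ := WithTop.ne_top_iff_exists.1 hne.2
  rw [← h₁, ← h₂] at hle
  have hle' : d₁ + d₂ ≤ d := by exact_mod_cast hle
  rw [map_mul]
  calc _ ≤ WithZero.exp d₁ * WithZero.exp d₂ := mul_le_mul' (hf Q d₁ h₁.symm) (hg Q d₂ h₂.symm)
    _ = WithZero.exp (d₁ + d₂) := (WithZero.exp_add _ _).symm
    _ ≤ _ := WithZero.exp_le_exp.2 hle'

theorem placeVal_C (Q : Place K) (c : K) : placeVal Q (RatFunc.C c) ≤ 1 := by
  classical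
  cases Q with
  | none =>
    by_cases h : c = 0
    · simp [h]
    · exact (RatFunc.inftyValuation.C K h).le
  | some Q =>
    rw [← RatFunc.algebraMap_C]
    exact Q.valuation_le_one _

theorem p_ne_zero_or (i : Fin (m + 1)) : L.p i ≠ 0 ∨ L.q i ≠ 0 := by
  obtain ⟨y, hy, h⟩ := L.meets_torus
  obtain ⟨s, t, rfl⟩ := Submodule.mem_span_pair.1 hy
  by_contra! hc
  exact h i (by simp [hc.1, hc.2])

theorem coord_ne_zero (i : Fin (m + 1)) : L.coord i ≠ 0 := by
  intro h
  have h0 := congrArg (fun f => Polynomial.coeff f 0) h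
  have h1 := congrArg (fun f => Polynomial.coeff f 1) h
  simp [coord, Polynomial.coeff_C] at h0 h1
  rcases L.p_ne_zero_or i with h | h
  · exact h h0
  · exact h h1

open Classical in
theorem placeVal_coord (Q : Place K) : ∃ k : ℤ, ∀ i,
    placeVal Q (algebraMap K[X] (RatFunc K) (L.coord i)) =
      WithZero.exp (k - if L.MeetsAt i Q then 1 else 0) := by
  cases Q with
  | none =>
    refine ⟨1, fun i => ?_⟩
    have h := RatFunc.inftyValuation.polynomial K (L.coord_ne_zero i)
    change RatFunc.inftyValuationDef K _ = _
    rw [h]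
    congr 1
    by_cases hq : L.q i = 0
    · simp [MeetsAt, coord, hq]
    · have : (L.coord i).natDegree = 1 := by
        rw [coord, add_comm]; exact Polynomial.natDegree_linear hq
      simp [MeetsAt, hq, this]
  | some Q =>
    refine ⟨0, fun i => ?_⟩
    change Q.valuation (RatFunc K) _ = _
    by_cases hq : L.coord i ∈ Q.asIdeal
    · have hqi : L.q i ≠ 0 := by
        intro h0
        have hp : L.p i ≠ 0 := (L.p_ne_zero_or i).resolve_right (by simp [h0])
        have : L.coord i = Polynomial.C (L.p i) := by simp [coord, h0]
        rw [this] at hq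
        exact Q.isPrime.ne_top (Ideal.eq_top_of_isUnit_mem _ hq
          (Polynomial.isUnit_C.2 hp.isUnit))
      have hirr : Irreducible (L.coord i) := by
        apply Polynomial.irreducible_of_degree_eq_one
        rw [coord, add_comm]; exact Polynomial.degree_linear hqi
      have hmax : (Ideal.span {L.coord i}).IsMaximal :=
        PrincipalIdealRing.isMaximal_of_irreducible hirr
      have heq : Q.asIdeal = Ideal.span {L.coord i} :=
        (hmax.eq_of_le Q.isPrime.ne_top ((Ideal.span_singleton_le_iff_mem _).2 hq)).symm
      rw [IsDedekindDomain.HeightOneSpectrum.valuation_of_algebraMap,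
        Q.intValuation_singleton (L.coord_ne_zero i) heq]
      simp [MeetsAt, hq]
    · rw [(IsDedekindDomain.HeightOneSpectrum.valuation_eq_one_iff_notMem Q).2 hq]
      simp [MeetsAt, hq]

/-- The restriction of the Laurent monomial `z^v` to `L`, where `z_i = y_i / y_0`. -/
def restrictMonomial (v : Fin m → ℤ) : RatFunc K :=
  ∏ j, (algebraMap K[X] (RatFunc K) (L.coord j.succ) /
    algebraMap K[X] (RatFunc K) (L.coord 0)) ^ v j

theorem restrictMonomial_add (v w : Fin m → ℤ) :
    L.restrictMonomial (v + w) = L.restrictMonomial v * L.restrictMonomial w := by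
  have h : ∀ i, algebraMap K[X] (RatFunc K) (L.coord i) ≠ 0 := fun i => by
    simpa using L.coord_ne_zero i
  simp only [restrictMonomial, Pi.add_apply, ← Finset.prod_mul_distrib]
  exact Finset.prod_congr rfl fun j _ => zpow_add₀ (div_ne_zero (h _) (h _)) _ _

theorem isSection_restrictMonomial {a : Fin (m + 1) → WithTop ℤ} {v : Fin m → ℤ}
    (h : ∀ i, ((-PolyhedralData.extend v i : ℤ) : WithTop ℤ) ≤ a i) :
    L.IsSection a (L.restrictMonomial v) := by
  classical
  intro Q d hd
  obtain ⟨k, hk⟩ := L.placeVal_coord Q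
  have hval : placeVal Q (L.restrictMonomial v) = WithZero.exp
      (∑ i with L.MeetsAt i Q, -PolyhedralData.extend v i) := by
    have hexp : ∀ (s : Finset (Fin m)) (f : Fin m → ℤ),
        ∏ j ∈ s, WithZero.exp (f j) = WithZero.exp (∑ j ∈ s, f j) := by
      intro s f
      induction s using Finset.induction_on with
      | empty => simp
      | insert a s ha ih => rw [Finset.prod_insert ha, Finset.sum_insert ha, ih, WithZero.exp_add]
    simp only [restrictMonomial, map_prod, map_zpow₀, map_div₀, hk, ← WithZero.exp_sub,
      ← WithZero.exp_zsmul, hexp]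
    congr 1
    rw [Finset.sum_filter, Fin.sum_univ_succ]
    simp only [PolyhedralData.extend, Fin.cons_zero, Fin.cons_succ, neg_neg, smul_eq_mul]
    split_ifs with h0
    · rw [← Finset.sum_add_distrib]
      refine Finset.sum_congr rfl fun j _ => ?_
      split_ifs <;> ring
    · rw [zero_add]
      refine Finset.sum_congr rfl fun j _ => ?_
      split_ifs <;> ring
  rw [hval, WithZero.exp_le_exp]
  have := Finset.sum_le_sum (s := Finset.univ.filter fun i => L.MeetsAt i Q) fun i _ => h i
  rw [hd] at this
  exact_mod_cast this

variable (D : PolyhedralData r m)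

/-- The ring `A(L) = ⨁_{u ∈ σ^∨ ∩ M} H⁰(L, O(∑ ⌊Δ_i(u)⌋ Q_i)) χ^u`, as a subring of `K(L)[M]`. -/
def sectionRing : Subalgebra K (AddMonoidAlgebra (RatFunc K) (Fin r → ℤ)) where
  carrier := {F | ∀ u, F.coeff u ≠ 0 →
    D.InDual u ∧ L.IsSection (fun i => D.floorVal i u) (F.coeff u)}
  add_mem' := by
    intro F G hF hG u hu
    simp only [AddMonoidAlgebra.coeff_add, Finsupp.add_apply] at hu ⊢
    by_cases h1 : F.coeff u = 0
    · rw [h1, zero_add] at hu ⊢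
      exact hG u hu
    · by_cases h2 : G.coeff u = 0
      · rw [h2, add_zero] at hu ⊢
        exact hF u hu
      · exact ⟨(hF u h1).1, L.isSection_add (hF u h1).2 (hG u h2).2⟩
  mul_mem' := by
    classical
    intro F G hF hG u hu
    rw [AddMonoidAlgebra.coeff_mul] at hu ⊢
    constructor
    · obtain ⟨a, ha, ha'⟩ := Finset.exists_ne_zero_of_sum_ne_zero hu
      obtain ⟨b, hb, hb'⟩ := Finset.exists_ne_zero_of_sum_ne_zero ha'
      by_cases hab : a + b = u
      · rw [← hab]
        exact D.inDual_add (hF a (Finsupp.mem_support_iff.1 ha)).1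
          (hG b (Finsupp.mem_support_iff.1 hb)).1
      · simp [hab] at hb'
    · refine Finset.sum_induction _ _ (fun _ _ => L.isSection_add) (L.isSection_zero _)
        fun a ha => ?_
      refine Finset.sum_induction _ _ (fun _ _ => L.isSection_add) (L.isSection_zero _)
        fun b hb => ?_
      have hFa := hF a (Finsupp.mem_support_iff.1 ha)
      have hGb := hG b (Finsupp.mem_support_iff.1 hb)
      dsimp only
      split_ifs with hab
      · rw [← hab]
        exact L.isSection_mul (fun i => D.floorVal_add i hFa.1 hGb.1) hFa.2 hGb.2
      · exact L.isSection_zero _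
  algebraMap_mem' := by
    classical
    intro c u hu
    have h : (algebraMap K (AddMonoidAlgebra (RatFunc K) (Fin r → ℤ)) c).coeff u =
        if u = 0 then RatFunc.C c else 0 := by
      rw [AddMonoidAlgebra.coe_algebraMap]
      simp [Finsupp.single_apply, eq_comm, RatFunc.algebraMap_eq_C]
    rw [h] at hu ⊢
    by_cases h0 : u = 0
    · subst h0
      simp only [if_true]
      refine ⟨fun x _ => by simp [pair], fun Q d hd => (placeVal_C Q c).trans ?_⟩
      rw [← WithZero.exp_zero, WithZero.exp_le_exp]
      have : (0 : WithTop ℤ) ≤ d := by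
        rw [← hd]
        exact Finset.sum_nonneg fun i _ => D.floorVal_zero i
      exact_mod_cast this
    · simp [h0] at hu

end TorusLine

section Embedding

variable {K : Type*} [Field K] {r m : ℕ} (D : PolyhedralData r m) (L : TorusLine K m)

variable (K) in
/-- The coordinate ring `A(C) = K[C^∨ ∩ (M × ℤ^m)]` of the toric variety `X(C)`. -/
abbrev coneRing : Type _ := AddMonoidAlgebra K D.dualMonoid

variable (K) in
/-- The inclusion `A(C) ⊆ K[M × ℤ^m]`. -/
def coneRingIncl : coneRing K D →ₐ[K] AddMonoidAlgebra K (Char r m) :=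
  AddMonoidAlgebra.mapDomainAlgHom K K D.dualMonoid.subtype

/-- The element `f · χ^u` of `K[M × ℤ^m]`, for `f ∈ K[ℤ^m]` and `u ∈ M`. -/
def twist (u : Fin r → ℤ) (f : Laurent K (Fin m)) : AddMonoidAlgebra K (Char r m) :=
  AddMonoidAlgebra.mapDomain (fun v => (u, v)) f

/-- The ideal `Ĩ(L) ⊆ A(C)` generated by all `f · χ^u ∈ A(C)` with `u ∈ M` and `f ∈ I(L)`, where
`I(L)` is the ideal of `L°`. -/
def tildeIdeal : Ideal (coneRing K D) :=
  Ideal.span {a | ∃ u : Fin r → ℤ, ∃ f ∈ torusIdeal L.torusPart, coneRingIncl K D a = twist u f}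

/-- The map `A(C) → A(L)`, `χ^{(u,v)} ↦ z^v|_L · χ^u`, given by restriction of sections. It
defines the embedding of `X(L) = Spec A(L)` into `X(C) = Spec A(C)`. -/
def restriction : coneRing K D →ₐ[K] L.sectionRing D :=
  AddMonoidAlgebra.lift K _ D.dualMonoid
    { toFun := fun c => ⟨AddMonoidAlgebra.single c.toAdd.1.1 (L.restrictMonomial c.toAdd.1.2), by
        intro u hu
        classical
        rw [AddMonoidAlgebra.coeff_single, Finsupp.single_apply] at hu ⊢
        split_ifs at hu ⊢ with h
        · rw [← h]
          exact ⟨D.inDual_of_mem c.toAdd.2,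
            L.isSection_restrictMonomial (D.neg_extend_le_floorVal c.toAdd.2)⟩
        · exact absurd rfl hu⟩
      map_one' := by
        apply Subtype.ext
        simp [TorusLine.restrictMonomial, AddMonoidAlgebra.one_def]
      map_mul' := fun a b => by
        apply Subtype.ext
        simp [L.restrictMonomial_add, AddMonoidAlgebra.single_mul_single] }

variable {D}

variable (K) in
/-- The map `S = K[x_u | u ∈ H] → A(C)`, `x_u ↦ χ^u`, which defines the embedding of `X(C)` into
affine space. -/
def toricMap (H : Finset D.dualMonoid) : MvPolynomial H K →ₐ[K] coneRing K D :=
  MvPolynomial.aeval fun h => AddMonoidAlgebra.single (h : D.dualMonoid) 1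

variable (K) in
/-- The toric ideal: the ideal of `X(C)` in `S`. -/
def toricIdeal (H : Finset D.dualMonoid) : Ideal (MvPolynomial H K) := RingHom.ker (toricMap K H)

/-- The ideal `J(L)` of `X(L)` in `S`, i.e. the kernel of `S → A(C) → A(L)`. -/
def idealJ (H : Finset D.dualMonoid) : Ideal (MvPolynomial H K) :=
  RingHom.ker ((restriction D L).comp (toricMap K H))

/-- `X(L)°`, the intersection of `X(L)` with the torus of affine space. -/
def varietyTorusPart (H : Finset D.dualMonoid) : Set (H → Kˣ) :=
  {x | ∀ f ∈ idealJ L H, MvPolynomial.eval (fun h => (x h : K)) f = 0}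

/-- The inclusion of a polynomial ring into the Laurent polynomial ring. -/
def toLaurent {ι : Type*} : MvPolynomial ι K →ₐ[K] Laurent K ι :=
  open Classical in MvPolynomial.aeval fun i => AddMonoidAlgebra.single (Pi.single i 1) 1

/-- `f` is a (possibly degenerate) binomial: a sum of two terms. -/
def IsBinomial {ι : Type*} (f : MvPolynomial ι K) : Prop :=
  ∃ (α β : ι →₀ ℕ) (a b : K), f = MvPolynomial.monomial α a + MvPolynomial.monomial β b

/-- The exponent `∑ α_u u` of the Laurent monomial to which `x^α` is mapped. -/
def latticeDegree (H : Finset D.dualMonoid) (α : H →₀ ℕ) : D.dualMonoid :=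
  α.sum fun h n => n • (h : D.dualMonoid)

/-- `F ∈ S` is a term-by-term lift of `a ∈ A(C)`: each term of `a` is replaced by one term of `S`
mapped to it. Equivalently, `F` is mapped to `a`, and distinct monomials of `F` are mapped to
distinct Laurent monomials. -/
def IsTermwiseLift (H : Finset D.dualMonoid) (F : MvPolynomial H K)
    (a : AddMonoidAlgebra K (Char r m)) : Prop :=
  coneRingIncl K D (toricMap K H F) = a ∧ Set.InjOn (latticeDegree H) (F.support : Set (H →₀ ℕ))

/-- `g` is the dehomogenization `a_0 + a_1 z_1 + ⋯ + a_m z_m` of a linear form. -/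
def IsDehomogenizedLinear (g : Laurent K (Fin m)) : Prop :=
  ∃ (a₀ : K) (a : Fin m → K), g = AddMonoidAlgebra.single 0 a₀ +
    ∑ j, AddMonoidAlgebra.single (Pi.single j 1) (a j)

/-- The elements `(g z^v) · χ^u` with `g ∈ G` and `(u, v) ∈ Q`. -/
def linearGenerators (G : Set (Laurent K (Fin m))) (Q : Set (Char r m)) :
    Set (AddMonoidAlgebra K (Char r m)) :=
  {a | ∃ g ∈ G, ∃ c ∈ Q, a = twist c.1 (g * AddMonoidAlgebra.single c.2 1)}

end Embedding

end SemiCanonical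

end

/-! Everything rests on a term criterion. `notMem_trop_iff` turns a monomial in an initial ideal
into a single element of the ideal whose lowest weight component is that monomial. For a
hypersurface the Nullstellensatz gives `mem_trop_hypersurface`: if no term of `g` is the only one of
minimal weight, the weight is tropical for `g`. Otherwise some `h ^ k = g * q` would have a monomial
as its lowest component, while the lowest component of `g` has two terms and so divides no monomial.

Generation. An element of `A(C)` restricts to zero on `L` exactly when each of its
`χ^u`-coefficients vanishes at the generic point of `L`. Homogenize such a coefficient. A form
vanishing on a line is a combination of monomial multiples of linear forms vanishing on it, in the
same degree (`mem_relationMultiples`). Dehomogenized, the multipliers satisfy exactly the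
inequalities of `P` (`mem_span_of_evalUnits_genericPoint`), so they are lattice points of `P` and
hence reached from the chosen generators of `P`. It must also be known that the linear forms of the
tropical basis span all linear relations of `L`. This is `relations_le_span`: if they spanned less,
the matroid of the quotient by their span would have rank at least three, and a weight built from a
flag of two flats would lie on all their tropical hypersurfaces but not on `trop L°`. Hence `Ĩ(L)`
is the kernel of restriction (`tildeIdeal_eq_ker`), and pulling back along the surjection from `S`
gives generators of `J(L)`.

Tropical basis. Let `w` lie on all the tropical hypersurfaces. The binomials make `w` constant on
the fibres of the degree map (`weight_eq_of_latticeDegree_eq`), so `w` comes from an additive `ω` on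
`M × ℤ^m` (`exists_extension`). A lift of `(g z^v) χ^u` has the same pattern of term weights as `g`
for the restriction of `ω` to `ℤ^m`, up to a shift. So this restriction lies in `trop V(g)`
(`mem_trop_hypersurface_of_lift`). One pair `(u,v)` for each `g` suffices, and one exists because
`P` has a lattice point, by Farkas' lemma and properness (`latticeP_nonempty`). Thus the restriction
is in `trop L°`. Finally, a Laurent polynomial vanishing on `X(L)°` pushes forward to one whose
slices vanish on `L°`, so a monomial initial form upstairs would give one for `L°`
(`mem_trop_varietyTorusPart`). -/

noncomputable section

namespace SemiCanonical

/-! ### Weight components in monoid algebras. -/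

section Components

variable {K : Type*} [Field K] {A : Type*}

open Classical in
/-- The sum of the terms of `f` of weight `c`. -/
def weightComponent (w : A → ℝ) (c : ℝ) : AddMonoidAlgebra K A →+ AddMonoidAlgebra K A where
  toFun f := AddMonoidAlgebra.ofCoeff (f.coeff.filter fun a => w a = c)
  map_zero' := by rw [AddMonoidAlgebra.coeff_zero, Finsupp.filter_zero, AddMonoidAlgebra.ofCoeff_zero]
  map_add' f g := by simp [Finsupp.filter_add]

open Classical in
theorem weightComponent_coeff (w : A → ℝ) (c : ℝ) (f : AddMonoidAlgebra K A) (a : A) :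
    (weightComponent w c f).coeff a = if w a = c then f.coeff a else 0 := by
  simp [weightComponent, Finsupp.filter_apply]

open Classical in
theorem weightComponent_single (w : A → ℝ) (c : ℝ) (a : A) (k : K) :
    weightComponent w c (AddMonoidAlgebra.single a k) =
      if w a = c then AddMonoidAlgebra.single a k else 0 := by
  ext b
  rw [weightComponent_coeff]
  by_cases hab : a = b
  · subst hab; split_ifs <;> simp
  · split_ifs <;> simp [hab]

/-- All terms of `f` have weight at least `c`. -/
def WeightGE (w : A → ℝ) (c : ℝ) (f : AddMonoidAlgebra K A) : Prop :=
  ∀ a, f.coeff a ≠ 0 → c ≤ w a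

theorem WeightGE.add {w : A → ℝ} {c : ℝ} {f g : AddMonoidAlgebra K A} (hf : WeightGE w c f)
    (hg : WeightGE w c g) : WeightGE w c (f + g) := by
  intro a ha
  by_cases h : f.coeff a = 0
  · exact hg a fun h' => ha (by simp [h, h'])
  · exact hf a h

theorem weightGE_zero (w : A → ℝ) (c : ℝ) : WeightGE w c (0 : AddMonoidAlgebra K A) :=
  fun a ha => absurd (by simp) ha

theorem exists_weightGE {w : A → ℝ} {f : AddMonoidAlgebra K A} (hf : f ≠ 0) :
    ∃ a, f.coeff a ≠ 0 ∧ WeightGE w (w a) f := by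
  have hne : f.coeff.support.Nonempty := by
    simpa [Finsupp.support_nonempty_iff] using hf
  obtain ⟨a, ha, h⟩ := f.coeff.support.exists_min_image w hne
  exact ⟨a, Finsupp.mem_support_iff.1 ha, fun b hb => h b (Finsupp.mem_support_iff.2 hb)⟩

theorem weightComponent_eq_zero {w : A → ℝ} {c d : ℝ} {f : AddMonoidAlgebra K A}
    (hf : WeightGE w d f) (h : c < d) : weightComponent w c f = 0 := by
  ext a
  rw [weightComponent_coeff]
  split_ifs with hw
  · by_contra hne
    exact absurd (hf a hne) (by rw [hw]; exact not_le.2 h)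
  · rfl

variable [AddCancelCommMonoid A] (w : A →+ ℝ)

theorem WeightGE.mul {w : A →+ ℝ} {c d : ℝ} {f g : AddMonoidAlgebra K A} (hf : WeightGE w c f)
    (hg : WeightGE w d g) : WeightGE w (c + d) (f * g) := by
  classical
  intro a ha
  rw [AddMonoidAlgebra.coeff_mul] at ha
  obtain ⟨x, hx, hx'⟩ := Finset.exists_ne_zero_of_sum_ne_zero ha
  obtain ⟨y, hy, hy'⟩ := Finset.exists_ne_zero_of_sum_ne_zero hx'
  by_cases hxy : x + y = a
  · rw [← hxy, map_add]
    exact add_le_add (hf x (Finsupp.mem_support_iff.1 hx)) (hg y (Finsupp.mem_support_iff.1 hy))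
  · simp [hxy] at hy'

/-- Multiplication by a monomial shifts all weights by the same amount; no lower bound on `f` is
needed. -/
theorem weightComponent_single_mul (c : ℝ) (a : A) (k : K) (f : AddMonoidAlgebra K A) :
    weightComponent w (w a + c) (AddMonoidAlgebra.single a k * f) =
      AddMonoidAlgebra.single a k * weightComponent w c f := by
  classical
  induction f using AddMonoidAlgebra.induction_linear with
  | zero => simp
  | add f g hf hg => rw [mul_add, map_add, map_add, mul_add, hf, hg]
  | single b l =>
    rw [AddMonoidAlgebra.single_mul_single, weightComponent_single, weightComponent_single,
      map_add]
    by_cases hb : w b = c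
    · simp [hb, AddMonoidAlgebra.single_mul_single]
    · simp [hb]

/-- Lowest components multiply: with all weights at least `c` and `d`, a product of two terms
reaches weight `c + d` only if both terms attain their bound. The bounds need not be attained, so
the components may be zero. -/
theorem weightComponent_mul {c d : ℝ} {f g : AddMonoidAlgebra K A} (hf : WeightGE w c f)
    (hg : WeightGE w d g) :
    weightComponent w (c + d) (f * g) = weightComponent w c f * weightComponent w d g := by
  classical
  have hsplit : ∀ {e : ℝ} {h : AddMonoidAlgebra K A}, WeightGE w e h →
      ∀ a, (h - weightComponent w e h).coeff a ≠ 0 → e < w a := by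
    intro e h hh a ha
    rw [AddMonoidAlgebra.coeff_sub, Finsupp.sub_apply, weightComponent_coeff] at ha
    split_ifs at ha with hw
    · simp at ha
    · exact lt_of_le_of_ne (hh a (by simpa using ha)) (Ne.symm hw)
  ext a
  rw [weightComponent_coeff]
  split_ifs with hw
  · rw [AddMonoidAlgebra.coeff_mul, AddMonoidAlgebra.coeff_mul]
    simp only [Finsupp.sum]
    have hs : ∀ (e : ℝ) (h : AddMonoidAlgebra K A),
        (weightComponent w e h).coeff.support ⊆ h.coeff.support := by
      intro e h x hx
      rw [Finsupp.mem_support_iff, weightComponent_coeff] at hx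
      split_ifs at hx
      · exact Finsupp.mem_support_iff.2 hx
      · exact absurd rfl hx
    rw [← Finset.sum_subset (hs c f)]
    · refine Finset.sum_congr rfl fun x hx => ?_
      have hx' : w x = c := by
        rw [Finsupp.mem_support_iff, weightComponent_coeff] at hx
        by_contra h
        simp [h] at hx
      rw [← Finset.sum_subset (hs d g)]
      · refine Finset.sum_congr rfl fun y hy => ?_
        have hy' : w y = d := by
          rw [Finsupp.mem_support_iff, weightComponent_coeff] at hy
          by_contra h
          simp [h] at hy
        simp [weightComponent_coeff, hx', hy']
      · intro y hy hy'
        split_ifs with hxy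
        · exfalso
          rw [Finsupp.notMem_support_iff, weightComponent_coeff] at hy'
          have : w y = d := by rw [← hxy, map_add, hx'] at hw; linarith
          rw [if_pos this] at hy'
          exact Finsupp.mem_support_iff.1 hy hy'
        · rfl
    · intro x hx hx'
      refine Finset.sum_eq_zero fun y hy => ?_
      split_ifs with hxy
      · exfalso
        rw [Finsupp.notMem_support_iff, weightComponent_coeff] at hx'
        have h1 := hf x (Finsupp.mem_support_iff.1 hx)
        have h2 := hg y (Finsupp.mem_support_iff.1 hy)
        have : w x = c := by rw [← hxy, map_add] at hw; linarith
        rw [if_pos this] at hx'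
        exact Finsupp.mem_support_iff.1 hx hx'
      · rfl
  · by_contra hne
    have hne' := Ne.symm hne
    rw [AddMonoidAlgebra.coeff_mul] at hne'
    obtain ⟨x, hx, hx'⟩ := Finset.exists_ne_zero_of_sum_ne_zero hne'
    obtain ⟨y, hy, hy'⟩ := Finset.exists_ne_zero_of_sum_ne_zero hx'
    rw [weightComponent_coeff, weightComponent_coeff] at hy'
    by_cases hxy : x + y = a
    · by_cases h1 : w x = c
      · by_cases h2 : w y = d
        · exact hw (by rw [← hxy, map_add, h1, h2])
        · simp [h2] at hy'
      · simp [h1] at hy'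
    · simp [hxy] at hy'

theorem weightComponent_pow {c : ℝ} {f : AddMonoidAlgebra K A} (hf : WeightGE w c f) (k : ℕ) :
    WeightGE w (k * c) (f ^ k) ∧
      weightComponent w (k * c) (f ^ k) = weightComponent w c f ^ k := by
  classical
  induction k with
  | zero =>
    constructor
    · intro a ha
      rw [pow_zero, AddMonoidAlgebra.one_def, AddMonoidAlgebra.coeff_single,
        Finsupp.single_apply] at ha
      have : a = 0 := by
        by_contra h
        exact ha (if_neg (Ne.symm h))
      simp [this]
    · ext a
      rw [weightComponent_coeff, pow_zero, pow_zero, AddMonoidAlgebra.one_def,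
        AddMonoidAlgebra.coeff_single, Finsupp.single_apply]
      by_cases h : 0 = a
      · subst h; simp
      · simp [h]
  | succ k ih =>
    have h : ((k + 1 : ℕ) : ℝ) * c = k * c + c := by push_cast; ring
    rw [h, pow_succ, pow_succ]
    exact ⟨ih.1.mul hf, by rw [weightComponent_mul w ih.1 hf, ih.2]⟩

/-- A product in which one factor has at least two terms is not a monomial. -/
theorem mul_ne_single [TwoUniqueSums A] {f g : AddMonoidAlgebra K A} (hf : 1 < f.coeff.support.card)
    {a : A} {k : K} (hk : k ≠ 0) : f * g ≠ AddMonoidAlgebra.single a k := by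
  classical
  intro h
  have hg : g.coeff.support.Nonempty := by
    rw [Finsupp.support_nonempty_iff]
    rintro h0
    have h0' : g = 0 := AddMonoidAlgebra.coeff_eq_zero.1 h0
    rw [h0', mul_zero] at h
    exact hk (AddMonoidAlgebra.single_eq_zero.1 h.symm)
  have hcard : 1 < f.coeff.support.card * g.coeff.support.card :=
    lt_of_lt_of_le hf (Nat.le_mul_of_pos_right _ hg.card_pos)
  -- Two distinct pairs of exponents have sums attained only once. No cancellation can occur there,
  -- so both sums would equal `a`, against uniqueness.
  obtain ⟨p, hp, q, hq, hpq, hup, huq⟩ := TwoUniqueSums.uniqueAdd_of_one_lt_card hcard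
  have key : ∀ x ∈ f.coeff.support ×ˢ g.coeff.support,
      UniqueAdd f.coeff.support g.coeff.support x.1 x.2 → x.1 + x.2 = a := by
    intro x hx hu
    rw [Finset.mem_product] at hx
    have h1 : (f * g).coeff (x.1 + x.2) = f.coeff x.1 * g.coeff x.2 := by
      rw [AddMonoidAlgebra.coeff_mul, Finsupp.sum, Finset.sum_eq_single x.1,
        Finsupp.sum, Finset.sum_eq_single x.2]
      · simp
      · intro y hy hne
        rw [if_neg]
        intro he
        exact hne (hu hx.1 hy he).2
      · intro h; exact absurd hx.2 h
      · intro y hy hne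
        refine Finset.sum_eq_zero fun z hz => if_neg ?_
        intro he
        exact hne (hu hy hz he).1
      · intro h; exact absurd hx.1 h
    by_contra hne
    rw [h, AddMonoidAlgebra.coeff_single, Finsupp.single_apply, if_neg (Ne.symm hne)] at h1
    exact mul_ne_zero (Finsupp.mem_support_iff.1 hx.1) (Finsupp.mem_support_iff.1 hx.2) h1.symm
  have hpa := key p hp hup
  have hqa := key q hq huq
  rw [Finset.mem_product] at hq
  have := hup hq.1 hq.2 (hqa.trans hpa.symm)
  exact hpq (Prod.ext this.1.symm this.2.symm)

end Components

/-! ### Term criteria for tropicalizations and the Nullstellensatz in the torus. -/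

section TropicalHypersurface

variable {K : Type*} [Field K] {ι : Type*} [Fintype ι]

/-- The weight as an additive map. -/
def weightHom (w : ι → ℝ) : (ι → ℤ) →+ ℝ where
  toFun := weight w
  map_zero' := by simp [weight]
  map_add' a b := by simp [weight, add_mul, Finset.sum_add_distrib]

theorem weightHom_apply (w : ι → ℝ) (a : ι → ℤ) : weightHom w a = weight w a := rfl

theorem initialForm_eq_weightComponent {w : ι → ℝ} {f : Laurent K ι} {a : ι → ℤ}
    (ha : f.coeff a ≠ 0) (h : WeightGE (weightHom w) (weightHom w a) f) :
    initialForm w f = weightComponent (weightHom w) (weightHom w a) f := by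
  classical
  ext b
  rw [weightComponent_coeff, initialForm, AddMonoidAlgebra.coeff_ofCoeff, Finsupp.filter_apply]
  by_cases hb : f.coeff b = 0
  · simp [hb]
  · refine if_congr ⟨fun h1 => ?_, fun h1 c hc => ?_⟩ rfl rfl
    · exact le_antisymm (h1 a (Finsupp.mem_support_iff.2 ha)) (h b hb)
    · have := h c (Finsupp.mem_support_iff.1 hc)
      rw [← h1] at this
      exact this

theorem mem_torusIdeal {Z : Set (ι → Kˣ)} {f : Laurent K ι} :
    f ∈ torusIdeal Z ↔ ∀ x ∈ Z, evalTorus x f = 0 := by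
  simp [torusIdeal, Submodule.mem_iInf, RingHom.mem_ker]

theorem evalTorus_single (x : ι → Kˣ) (a : ι → ℤ) (c : K) :
    evalTorus x (AddMonoidAlgebra.single a c) = c * ((∏ i, x i ^ a i : Kˣ) : K) := by
  simp [evalTorus]

/-- The homogeneous elements of an initial ideal are components of elements of the ideal. -/
theorem exists_weightComponent_of_mem_initialIdeal {w : ι → ℝ} {I : Ideal (Laurent K ι)}
    {p : Laurent K ι} (hp : p ∈ initialIdeal w I) (c : ℝ) :
    ∃ h ∈ I, WeightGE (weightHom w) c h ∧
      weightComponent (weightHom w) c h = weightComponent (weightHom w) c p := by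
  induction hp using Submodule.span_induction generalizing c with
  | mem p hp =>
    obtain ⟨f, hf, rfl⟩ := hp
    by_cases h0 : f = 0
    · refine ⟨0, I.zero_mem, weightGE_zero _ _, ?_⟩
      subst h0
      congr 1
    obtain ⟨a, ha, hge⟩ := exists_weightGE (w := weightHom w) h0
    rw [initialForm_eq_weightComponent ha hge]
    by_cases hc : c = weightHom w a
    · subst hc
      refine ⟨f, hf, hge, ?_⟩
      ext b
      simp only [weightComponent_coeff]
      split_ifs <;> rfl
    · refine ⟨0, I.zero_mem, weightGE_zero _ _, ?_⟩
      ext b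
      simp only [weightComponent_coeff]
      split_ifs with h1 h2
      · exact absurd (h1.symm.trans h2) hc
      · simp
      · simp
  | zero => exact ⟨0, I.zero_mem, weightGE_zero _ _, rfl⟩
  | add p q _ _ hp hq =>
    obtain ⟨f, hf, h1, h2⟩ := hp c
    obtain ⟨g, hg, h3, h4⟩ := hq c
    exact ⟨f + g, I.add_mem hf hg, h1.add h3, by rw [map_add, map_add, h2, h4]⟩
  -- The multiplier is split into monomials. A monomial shifts the weight, which is why the
  -- induction keeps `c` general.
  | smul r p _ hp =>
    induction r using AddMonoidAlgebra.induction_linear with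
    | zero => exact ⟨0, I.zero_mem, weightGE_zero _ _, by simp⟩
    | add r s hr hs =>
      obtain ⟨f, hf, h1, h2⟩ := hr
      obtain ⟨g, hg, h3, h4⟩ := hs
      exact ⟨f + g, I.add_mem hf hg, h1.add h3, by rw [add_smul, map_add, map_add, h2, h4]⟩
    | single a k =>
      obtain ⟨f, hf, h1, h2⟩ := hp (c - weightHom w a)
      refine ⟨AddMonoidAlgebra.single a k * f, I.mul_mem_left _ hf, ?_, ?_⟩
      · have h3 : WeightGE (weightHom w) (weightHom w a) (AddMonoidAlgebra.single a k) := by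
          classical
          intro b hb
          rw [AddMonoidAlgebra.coeff_single, Finsupp.single_apply] at hb
          have : a = b := by
            by_contra h
            exact hb (if_neg h)
          rw [this]
        have := h3.mul h1
        rwa [add_sub_cancel] at this
      · have h3 := weightComponent_single_mul (weightHom w) (c - weightHom w a) a k
        rw [add_sub_cancel] at h3
        rw [h3, h2, smul_eq_mul, h3]

/-- The monomials in an initial ideal are initial forms of elements of the ideal. -/
theorem notMem_trop_iff {Z : Set (ι → Kˣ)} {w : ι → ℝ} :
    w ∉ trop Z ↔ ∃ α, ∃ h ∈ torusIdeal Z, WeightGE (weightHom w) (weightHom w α) h ∧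
      weightComponent (weightHom w) (weightHom w α) h = AddMonoidAlgebra.single α 1 := by
  constructor
  · intro h
    simp only [trop, Set.mem_ofPred_eq, not_forall, not_not] at h
    obtain ⟨α, hα⟩ := h
    obtain ⟨h, h1, h2, h3⟩ := exists_weightComponent_of_mem_initialIdeal hα (weightHom w α)
    exact ⟨α, h, h1, h2, by rw [h3, weightComponent_single, if_pos rfl]⟩
  · rintro ⟨α, h, h1, h2, h3⟩ hw
    refine hw α ?_
    have ha : h.coeff α ≠ 0 := by
      have := congrArg (fun p => p.coeff α) h3
      simp only [weightComponent_coeff, if_true, AddMonoidAlgebra.coeff_single,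
        Finsupp.single_eq_same] at this
      rw [this]
      exact one_ne_zero
    rw [← h3, ← initialForm_eq_weightComponent ha h2]
    exact Ideal.subset_span ⟨h, h1, rfl⟩

/-- At a point of the tropicalization, no term of a polynomial of the ideal is the only one of
minimal weight. -/
theorem exists_weight_le_of_mem_trop {Z : Set (ι → Kˣ)} {w : ι → ℝ} (hw : w ∈ trop Z)
    {f : Laurent K ι} (hf : f ∈ torusIdeal Z) {α : ι → ℤ} (hα : f.coeff α ≠ 0) :
    ∃ β, f.coeff β ≠ 0 ∧ β ≠ α ∧ weightHom w β ≤ weightHom w α := by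
  classical
  by_contra! hcon
  -- Normalizing the coefficient at `α` makes `f` itself the witness for the monomial at `α`.
  refine absurd hw (notMem_trop_iff.2 ⟨α, AddMonoidAlgebra.single 0 (f.coeff α)⁻¹ * f,
    Ideal.mul_mem_left _ _ hf, ?_, ?_⟩)
  · intro β hβ
    have hβ' : f.coeff β ≠ 0 := by
      intro h
      apply hβ
      simp [AddMonoidAlgebra.coeff_single_mul_apply, h]
    by_cases h : β = α
    · rw [h]
    · exact (hcon β hβ' h).le
  · ext β
    rw [weightComponent_coeff, AddMonoidAlgebra.coeff_single, Finsupp.single_apply,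
      AddMonoidAlgebra.coeff_single_mul_apply, neg_zero, zero_add]
    by_cases h : β = α
    · subst h
      simp [hα]
    · rw [if_neg (Ne.symm h)]
      split_ifs with hwt
      · by_cases h0 : f.coeff β = 0
        · simp [h0]
        · exact absurd hwt (hcon β h0 h).ne'
      · rfl

theorem torusIdeal_anti {Z Z' : Set (ι → Kˣ)} (h : Z ⊆ Z') : torusIdeal Z' ≤ torusIdeal Z :=
  fun _ hf => mem_torusIdeal.2 fun x hx => mem_torusIdeal.1 hf x (h hx)

theorem trop_mono {Z Z' : Set (ι → Kˣ)} (h : Z ⊆ Z') : trop Z ⊆ trop Z' := by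
  intro w hw α hα
  exact hw α (Ideal.span_mono (Set.image_mono (torusIdeal_anti h)) hα)

theorem mem_torusIdeal_hypersurface (f : Laurent K ι) : f ∈ torusIdeal (hypersurface f) :=
  mem_torusIdeal.2 fun _ hx => hx

theorem subset_hypersurface {Z : Set (ι → Kˣ)} {f : Laurent K ι} (hf : f ∈ torusIdeal Z) :
    Z ⊆ hypersurface f := fun x hx => mem_torusIdeal.1 hf x hx

theorem toLaurent_monomial (α : ι →₀ ℕ) (c : K) :
    toLaurent (MvPolynomial.monomial α c) =
      AddMonoidAlgebra.single (fun i => (α i : ℤ)) c := by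
  classical
  rw [toLaurent, MvPolynomial.aeval_monomial, Finsupp.prod_fintype _ _ (by simp)]
  simp only [AddMonoidAlgebra.single_pow, one_pow, AddMonoidAlgebra.prod_single,
    Finset.prod_const_one, AddMonoidAlgebra.coe_algebraMap, Function.comp_apply,
    AddMonoidAlgebra.single_mul_single, zero_add, mul_one, Algebra.algebraMap_self, RingHom.id_apply]
  congr 1
  ext j
  simp [Finset.sum_apply, Pi.single_apply]

theorem evalTorus_toLaurent (x : ι → Kˣ) (f : MvPolynomial ι K) :
    evalTorus x (toLaurent f) = MvPolynomial.eval (fun i => (x i : K)) f := by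
  induction f using MvPolynomial.induction_on' with
  | monomial α c =>
    rw [toLaurent_monomial, evalTorus_single, MvPolynomial.eval_monomial,
      Finsupp.prod_fintype _ _ (by simp)]
    simp
  | add f g hf hg => rw [map_add, map_add, map_add, hf, hg]

theorem toLaurent_coeff (f : MvPolynomial ι K) (α : ι →₀ ℕ) :
    (toLaurent f).coeff (fun i => (α i : ℤ)) = f.coeff α := by
  classical
  induction f using MvPolynomial.induction_on' with
  | monomial β c =>
    rw [toLaurent_monomial, AddMonoidAlgebra.coeff_single, Finsupp.single_apply,
      MvPolynomial.coeff_monomial]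
    refine if_congr ⟨fun h => ?_, fun h => by rw [h]⟩ rfl rfl
    ext i
    exact_mod_cast congrFun h i
  | add f g hf hg => rw [map_add, AddMonoidAlgebra.coeff_add, Finsupp.add_apply, hf, hg,
      MvPolynomial.coeff_add]

theorem exists_of_toLaurent_coeff_ne_zero {f : MvPolynomial ι K} {β : ι → ℤ}
    (h : (toLaurent f).coeff β ≠ 0) : ∃ α : ι →₀ ℕ, β = fun i => (α i : ℤ) := by
  classical
  induction f using MvPolynomial.induction_on' with
  | monomial α c =>
    rw [toLaurent_monomial, AddMonoidAlgebra.coeff_single, Finsupp.single_apply] at h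
    refine ⟨α, ?_⟩
    by_contra hne
    exact h (if_neg (Ne.symm hne))
  | add f g hf hg =>
    rw [map_add, AddMonoidAlgebra.coeff_add, Finsupp.add_apply] at h
    by_cases h0 : (toLaurent f).coeff β = 0
    · exact hg (by rwa [h0, zero_add] at h)
    · exact hf h0

/-- Every Laurent polynomial is a monomial times a polynomial. -/
theorem exists_toLaurent_eq (f : Laurent K ι) :
    ∃ (n : ι → ℤ) (p : MvPolynomial ι K), AddMonoidAlgebra.single n 1 * f = toLaurent p := by
  classical
  induction f using AddMonoidAlgebra.induction_linear with
  | zero => exact ⟨0, 0, by simp⟩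
  | add f g hf hg =>
    obtain ⟨n, p, hp⟩ := hf
    obtain ⟨n', q, hq⟩ := hg
    -- The two clearing monomials are brought to their coordinatewise maximum, each by a factor with
    -- nonnegative exponents.
    have key : ∀ (a b : ι → ℤ), AddMonoidAlgebra.single (a ⊔ b) (1 : K) =
        toLaurent (MvPolynomial.monomial
          (Finsupp.equivFunOnFinite.symm fun i => ((a ⊔ b) i - a i).toNat) 1) *
        AddMonoidAlgebra.single a 1 := by
      intro a b
      rw [toLaurent_monomial, AddMonoidAlgebra.single_mul_single, mul_one]
      congr 1
      ext i
      simp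
    refine ⟨n ⊔ n', MvPolynomial.monomial
          (Finsupp.equivFunOnFinite.symm fun i => ((n ⊔ n') i - n i).toNat) 1 * p +
        MvPolynomial.monomial
          (Finsupp.equivFunOnFinite.symm fun i => ((n' ⊔ n) i - n' i).toNat) 1 * q, ?_⟩
    rw [mul_add, map_add, map_mul, map_mul, ← hp, ← hq, ← mul_assoc, ← mul_assoc, ← key, ← key,
      sup_comm n' n]
  | single a c =>
    refine ⟨-a, MvPolynomial.C c, ?_⟩
    rw [AddMonoidAlgebra.single_mul_single, MvPolynomial.C_apply, toLaurent_monomial]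
    simp
    rfl

/-- The Nullstellensatz for hypersurfaces in the torus. -/
theorem exists_pow_eq_mul_of_mem_torusIdeal [IsAlgClosed K] {g h : Laurent K ι}
    (hh : h ∈ torusIdeal (hypersurface g)) : ∃ (k : ℕ) (q : Laurent K ι), h ^ k = g * q := by
  classical
  obtain ⟨n, p, hp⟩ := exists_toLaurent_eq h
  obtain ⟨n', g', hg'⟩ := exists_toLaurent_eq g
  have hunit : ∀ a : ι → ℤ, IsUnit (AddMonoidAlgebra.single a 1 : Laurent K ι) := fun a =>
    IsUnit.of_mul_eq_one (AddMonoidAlgebra.single (-a) 1) (by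
      rw [AddMonoidAlgebra.single_mul_single]; simp [AddMonoidAlgebra.one_def])
  let e : MvPolynomial ι K := ∏ i, MvPolynomial.X i
  have he : toLaurent e = AddMonoidAlgebra.single (1 : ι → ℤ) 1 := by
    have : e = MvPolynomial.monomial (Finsupp.equivFunOnFinite.symm fun _ => 1) 1 := by
      rw [MvPolynomial.monomial_eq, Finsupp.prod_fintype _ _ (by simp)]
      simp [e]
    rw [this, toLaurent_monomial]
    congr 1
  -- The factor `e` kills the coordinate hyperplanes, where nothing is known about `p`. It becomes a
  -- unit in the Laurent ring and is removed at the end.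
  have hmem : p * e ∈ MvPolynomial.vanishingIdeal K
      (MvPolynomial.zeroLocus K (Ideal.span {g'})) := by
    intro x hx
    by_cases h0 : ∃ i, x i = 0
    · obtain ⟨i, hi⟩ := h0
      have : MvPolynomial.aeval x e = 0 := by
        simp only [e, map_prod, MvPolynomial.aeval_X]
        exact Finset.prod_eq_zero (Finset.mem_univ i) hi
      rw [map_mul, this, mul_zero]
    · push Not at h0
      let y : ι → Kˣ := fun i => Units.mk0 (x i) (h0 i)
      have hy : ∀ P : MvPolynomial ι K, evalTorus y (toLaurent P) = MvPolynomial.aeval x P := by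
        intro P
        rw [evalTorus_toLaurent]
        rfl
      have h1 : MvPolynomial.aeval x g' = 0 := hx g' (Ideal.subset_span rfl)
      rw [← hy, ← hg', map_mul] at h1
      have h2 : evalTorus y g = 0 :=
        (mul_eq_zero.1 h1).resolve_left ((hunit n').map (evalTorus y)).ne_zero
      have h3 := mem_torusIdeal.1 hh y h2
      rw [map_mul, ← hy p, ← hp, map_mul, h3, mul_zero, zero_mul]
  rw [MvPolynomial.vanishingIdeal_zeroLocus_eq_radical, Ideal.mem_radical_iff] at hmem
  obtain ⟨k, hk⟩ := hmem
  obtain ⟨q, hq⟩ := Ideal.mem_span_singleton'.1 hk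
  have h4 := congrArg toLaurent hq
  rw [map_mul, map_pow, map_mul, ← hp, ← hg', he, mul_pow, mul_pow] at h4
  obtain ⟨u, hu⟩ := (((hunit n).pow k).mul ((hunit 1).pow k))
  refine ⟨k, AddMonoidAlgebra.single n' 1 * toLaurent q * (↑u⁻¹ : Laurent K ι), ?_⟩
  have h5 : (u : Laurent K ι) * h ^ k = toLaurent q * (AddMonoidAlgebra.single n' 1 * g) := by
    rw [hu, h4]; ring
  calc h ^ k = (↑u⁻¹ : Laurent K ι) * (↑u * h ^ k) := by rw [← mul_assoc, Units.inv_mul, one_mul]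
    _ = _ := by rw [h5]; ring

/-- The case `g = 0` of the Nullstellensatz makes `h` nilpotent. -/
theorem eq_zero_of_forall_evalTorus [IsAlgClosed K] {h : Laurent K ι}
    (hh : ∀ x, evalTorus x h = 0) : h = 0 := by
  obtain ⟨k, q, hk⟩ := exists_pow_eq_mul_of_mem_torusIdeal (g := 0)
    (mem_torusIdeal.2 fun x _ => hh x)
  rw [zero_mul] at hk
  exact eq_zero_of_pow_eq_zero hk

/-- A point at which no term of `g` is the only one of minimal weight lies on the tropical
hypersurface of `g`. -/
theorem mem_trop_hypersurface [IsAlgClosed K] {w : ι → ℝ} {g : Laurent K ι}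
    (hg : ∀ α, g.coeff α ≠ 0 → ∃ β, g.coeff β ≠ 0 ∧ β ≠ α ∧ weightHom w β ≤ weightHom w α) :
    w ∈ trop (hypersurface g) := by
  classical
  by_contra hw
  obtain ⟨α, h, h1, h2, h3⟩ := notMem_trop_iff.1 hw
  obtain ⟨k, q, hk⟩ := exists_pow_eq_mul_of_mem_torusIdeal h1
  obtain ⟨h4, h5⟩ := weightComponent_pow (weightHom w) h2 k
  rw [h3, AddMonoidAlgebra.single_pow, one_pow] at h5
  have hne : h ^ k ≠ 0 := by
    intro h0
    rw [h0, map_zero] at h5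
    exact one_ne_zero (AddMonoidAlgebra.single_eq_zero.1 h5.symm)
  have hg0 : g ≠ 0 := by rintro rfl; exact hne (by rw [hk, zero_mul])
  have hq0 : q ≠ 0 := by rintro rfl; exact hne (by rw [hk, mul_zero])
  obtain ⟨a, ha, hga⟩ := exists_weightGE (w := weightHom w) hg0
  obtain ⟨b, hb, hqb⟩ := exists_weightGE (w := weightHom w) hq0
  have h6 := weightComponent_mul (weightHom w) hga hqb
  rw [← hk] at h6
  have hcard : 1 < (weightComponent (weightHom w) (weightHom w a) g).coeff.support.card := by
    obtain ⟨c, hc, hca, hcw⟩ := hg a ha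
    refine Finset.one_lt_card.2 ⟨a, ?_, c, ?_, hca.symm⟩
    · rw [Finsupp.mem_support_iff, weightComponent_coeff, if_pos rfl]
      exact ha
    · rw [Finsupp.mem_support_iff, weightComponent_coeff, if_pos (le_antisymm hcw (hga c hc))]
      exact hc
  have hqc : weightComponent (weightHom w) (weightHom w b) q ≠ 0 := by
    intro h0
    have := congrArg (fun p => p.coeff b) h0
    simp only [weightComponent_coeff, if_true] at this
    exact hb this
  have hgc : weightComponent (weightHom w) (weightHom w a) g ≠ 0 := by
    intro h0
    rw [h0] at hcard
    simp at hcard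
  -- Both sides are the minimal weight of `h ^ k = g * q`: the component at each of these weights is
  -- nonzero, and nothing lies below.
  have heq : (k : ℝ) * weightHom w α = weightHom w a + weightHom w b := by
    rcases lt_trichotomy ((k : ℝ) * weightHom w α) (weightHom w a + weightHom w b) with hlt | h | hlt
    · rw [weightComponent_eq_zero (by rw [hk]; exact hga.mul hqb) hlt] at h5
      exact absurd (AddMonoidAlgebra.single_eq_zero.1 h5.symm) one_ne_zero
    · exact h
    · rw [weightComponent_eq_zero h4 hlt] at h6
      exact absurd h6.symm (mul_ne_zero hgc hqc)
  rw [← heq, h5] at h6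
  exact mul_ne_single hcard one_ne_zero h6.symm

end TropicalHypersurface

/-! ### Convexity: inequalities for the dual cone, and lattice points of P. -/

/-- Farkas' lemma for finitely many vectors over a linearly ordered field. -/
theorem farkas {k V ι : Type*} [Field k] [LinearOrder k] [IsStrictOrderedRing k] [AddCommGroup V]
    [Module k V] (s : Finset ι) (a : ι → V) (b : V) :
    (∃ c : ι → k, (∀ i ∈ s, 0 ≤ c i) ∧ ∑ i ∈ s, c i • a i = b) ∨
      ∃ f : Module.Dual k V, (∀ i ∈ s, 0 ≤ f (a i)) ∧ f b < 0 := by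
  classical
  induction s using Finset.induction_on generalizing a b with
  | empty =>
    by_cases hb : b = 0
    · exact Or.inl ⟨0, by simp, by simp [hb]⟩
    · obtain ⟨f, hf⟩ := Module.Projective.exists_dual_ne_zero k hb
      rcases lt_or_gt_of_ne hf with h | h
      · exact Or.inr ⟨f, by simp, h⟩
      · exact Or.inr ⟨-f, by simp, by simpa using h⟩
  | insert j s hj ih =>
    rcases ih a b with ⟨c, hc, hcb⟩ | ⟨f, hf, hfb⟩
    · refine Or.inl ⟨fun i => if i = j then 0 else c i, ?_, ?_⟩
      · intro i hi
        dsimp only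
        split_ifs with h
        · exact le_rfl
        · exact hc i (Finset.mem_of_mem_insert_of_ne hi h)
      · rw [Finset.sum_insert hj]
        dsimp only
        rw [if_pos rfl, zero_smul, zero_add, ← hcb]
        refine Finset.sum_congr rfl fun i hi => ?_
        rw [if_neg]
        rintro rfl
        exact hj hi
    · by_cases hfj : 0 ≤ f (a j)
      · refine Or.inr ⟨f, fun i hi => ?_, hfb⟩
        rcases Finset.mem_insert.1 hi with rfl | hi
        · exact hfj
        · exact hf i hi
      push Not at hfj
      -- Here `f` separates `b` from the old vectors but is negative on `a j`. Project everything
      -- along `a j` onto the kernel of `f`. A representation of the projected `b` lifts with a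
      -- nonnegative coefficient at `a j`, by the signs of `f`; a separating functional is composed
      -- with the projection.
      rcases ih (fun i => a i - (f (a i) / f (a j)) • a j) (b - (f b / f (a j)) • a j) with
        ⟨c, hc, hcb⟩ | ⟨g, hg, hgb⟩
      · refine Or.inl ⟨fun i => if i = j then f b / f (a j) - ∑ i ∈ s, c i * (f (a i) / f (a j))
          else c i, ?_, ?_⟩
        · intro i hi
          dsimp only
          split_ifs with h
          · have h1 : 0 ≤ f b / f (a j) := div_nonneg_of_nonpos hfb.le hfj.le
            have h2 : ∑ i ∈ s, c i * (f (a i) / f (a j)) ≤ 0 := Finset.sum_nonpos fun i hi =>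
              mul_nonpos_of_nonneg_of_nonpos (hc i hi) (div_nonpos_of_nonneg_of_nonpos (hf i hi) hfj.le)
            linarith
          · exact hc i (Finset.mem_of_mem_insert_of_ne hi h)
        · rw [Finset.sum_insert hj]
          dsimp only
          rw [if_pos rfl]
          have h1 : ∑ i ∈ s, (if i = j then f b / f (a j) - ∑ i ∈ s, c i * (f (a i) / f (a j))
              else c i) • a i = ∑ i ∈ s, c i • a i := by
            refine Finset.sum_congr rfl fun i hi => ?_
            rw [if_neg]
            rintro rfl
            exact hj hi
          rw [h1]
          simp only [smul_sub, Finset.sum_sub_distrib, smul_smul, ← Finset.sum_smul] at hcb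
          rw [sub_smul, sub_add_eq_add_sub, add_sub_assoc, hcb]
          abel
      · have key : ∀ x, (g - (g (a j) / f (a j)) • f) x = g (x - (f x / f (a j)) • a j) := by
          intro x
          simp only [LinearMap.sub_apply, LinearMap.smul_apply, map_sub, map_smul, smul_eq_mul]
          ring
        refine Or.inr ⟨g - (g (a j) / f (a j)) • f, fun i hi => ?_, ?_⟩
        · rw [key]
          rcases Finset.mem_insert.1 hi with rfl | hi
          · rw [div_self hfj.ne, one_smul, sub_self, map_zero]
          · exact hg i hi
        · rw [key]; exact hgb

theorem pair_add {r : ℕ} (u : Fin r → ℤ) (x y : Fin r → ℚ) :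
    pair u (x + y) = pair u x + pair u y := by
  simp [pair, mul_add, Finset.sum_add_distrib]

theorem pair_smul {r : ℕ} (u : Fin r → ℤ) (c : ℚ) (x : Fin r → ℚ) :
    pair u (c • x) = c * pair u x := by
  simp [pair, Finset.mul_sum, mul_left_comm]

theorem pair_zero {r : ℕ} (u : Fin r → ℤ) : pair u 0 = 0 := by simp [pair]

theorem pair_eVec {m : ℕ} (v : Fin m → ℤ) (i : Fin (m + 1)) :
    pair v (eVec i) = (PolyhedralData.extend v i : ℤ) := by
  refine Fin.cases ?_ (fun j => ?_) i
  · simp [pair, eVec, PolyhedralData.extend]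
  · simp [pair, eVec, PolyhedralData.extend, Pi.single_apply]

namespace PolyhedralData

variable {r m : ℕ} (D : PolyhedralData r m)

/-- Replaces the real infimum by rational inequalities. For an empty polyhedron both the bound `⊤`
and the quantifier impose nothing. -/
theorem coe_le_minVal_iff {u : Fin r → ℤ} (hu : D.InDual u) (i : Fin (m + 1)) (n : ℤ) :
    (((n : ℤ) : ℝ) : WithTop ℝ) ≤ D.minVal i u ↔ ∀ x ∈ D.Δ i, (n : ℚ) ≤ pair u x := by
  unfold minVal
  by_cases h : (D.Δ i).Nonempty
  · rw [if_pos h, WithTop.coe_le_coe, le_csInf_iff (D.bddBelow_pair i hu) (h.image _)]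
    simp only [Set.forall_mem_image]
    refine forall₂_congr fun x _ => ?_
    exact_mod_cast Iff.rfl
  · rw [if_neg h]
    rw [Set.not_nonempty_iff_eq_empty] at h
    simp [h]

/-- It suffices to pair with the generators of `C`. With `v_0 = -(v_1 + ⋯ + v_m)` the index `0` is
on the same footing as the others. -/
theorem mem_dualMonoid_iff {c : Char r m} : c ∈ D.dualMonoid ↔
    D.InDual c.1 ∧ ∀ i, ∀ x ∈ D.Δ i, ((-extend c.2 i : ℤ) : ℚ) ≤ pair c.1 x := by
  constructor
  · intro hc
    refine ⟨D.inDual_of_mem hc, fun i x hx => ?_⟩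
    have h1 := hc (x, eVec i)
      (Submodule.subset_span (Or.inl (Set.mem_iUnion.2 ⟨i, hx, rfl⟩)))
    rw [bigPair, pair_eVec] at h1
    push_cast
    linarith
  · rintro ⟨h1, h2⟩ x hx
    induction hx using Submodule.span_induction with
    | mem x hx =>
      rcases hx with hx | ⟨hx, hx'⟩
      · obtain ⟨i, hx, hx'⟩ := Set.mem_iUnion.1 hx
        rw [Set.mem_singleton_iff] at hx'
        have := h2 i _ hx
        rw [bigPair, hx', pair_eVec]
        push_cast at this
        linarith
      · rw [Set.mem_singleton_iff] at hx'
        rw [bigPair, hx', pair_zero, add_zero]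
        exact h1 _ hx
    | zero => simp [bigPair, pair]
    | add x y _ _ hx hy =>
      have : bigPair c (x + y) = bigPair c x + bigPair c y := by
        simp only [bigPair, Prod.fst_add, Prod.snd_add, pair_add]; ring
      rw [this]
      exact add_nonneg hx hy
    | smul a x _ hx =>
      have : bigPair c (a • x) = (a : ℚ) * bigPair c x := by
        change pair c.1 ((a : ℚ) • x.1) + pair c.2 ((a : ℚ) • x.2) = _
        rw [pair_smul, pair_smul, bigPair]; ring
      rw [this]
      exact mul_nonneg a.2 hx

theorem mem_latticeP_iff {c : Char r m} : c ∈ D.latticeP ↔ D.InDual c.1 ∧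
    (∀ j : Fin m, ∀ x ∈ D.Δ j.succ, ((-c.2 j : ℤ) : ℚ) ≤ pair c.1 x) ∧
      ∀ x ∈ D.Δ 0, ((∑ j, c.2 j + 1 : ℤ) : ℚ) ≤ pair c.1 x := by
  unfold latticeP
  rw [Set.mem_ofPred_eq]
  refine and_congr_right fun h => ?_
  rw [D.coe_le_minVal_iff h]
  refine and_congr_left fun _ => forall_congr' fun j => ?_
  have := D.coe_le_minVal_iff h j.succ (-c.2 j)
  rw [← this]

/-- The sum of the polyhedra does not contain the origin. -/
theorem not_sum_eq_zero (y : Fin (m + 1) → (Fin r → ℚ)) (hy : ∀ i, y i ∈ D.Δ i) :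
    ∑ i, y i ≠ 0 := by
  intro h0
  -- If zero were a sum of points of the `Δ_i`, adding `s` to the point of `Δ_0` would write every
  -- `s ∈ σ` as such a sum, against properness.
  refine D.proper.2 fun s hs => ⟨Function.update y 0 (y 0 + s), fun i => ?_, ?_⟩
  · by_cases hi : i = 0
    · subst hi
      rw [Function.update_self]
      obtain ⟨V, hV⟩ := D.Δ_polyhedron 0
      have h1 := hy 0
      rw [hV] at h1 ⊢
      obtain ⟨a, ha, b, hb, hab⟩ := h1
      exact ⟨a, ha, b + s, D.σ.add_mem hb hs, by rw [← hab]; exact (add_assoc a b s).symm⟩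
    · rw [Function.update_of_ne hi]
      exact hy i
  · rw [Fin.sum_univ_succ] at h0 ⊢
    rw [Function.update_self]
    have : ∀ j : Fin m, Function.update y 0 (y 0 + s) j.succ = y j.succ := fun j =>
      Function.update_of_ne (Fin.succ_ne_zero j) _ _
    simp only [this]
    rw [add_right_comm, h0, zero_add]

/-- Farkas for the vectors `(vertex of Δ_i, e_i)`, in `m + 1` independent directions, and
`(generator of σ, 0)`, with target `(0, 1)`. The target in their cone would mean one convex
combination per `Δ_i`, together with an element of `σ`, adding up to zero. The functional found is a
rational `(u, v_0, …, v_m)` with `v_i ≥ -Δ_i(u)` and negative coordinate sum. -/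
theorem exists_separating : ∃ f : Module.Dual ℚ ((Fin r → ℚ) × (Fin (m + 1) → ℚ)),
    (∀ s ∈ D.σ, 0 ≤ f (s, 0)) ∧ (∀ i, ∀ x ∈ D.Δ i, 0 ≤ f (x, Pi.single i 1)) ∧ f (0, 1) < 0 := by
  classical
  choose V hV using D.Δ_polyhedron
  obtain ⟨S, hS⟩ := D.σ_fg
  have hSσ : ∀ s ∈ S, s ∈ D.σ := fun s hs => hS ▸ Submodule.subset_span hs
  let a : ((Σ i, V i) ⊕ S) → (Fin r → ℚ) × (Fin (m + 1) → ℚ) :=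
    Sum.elim (fun x => (x.2.1, Pi.single x.1 1)) (fun s => (s.1, 0))
  rcases farkas (k := ℚ) Finset.univ a (0, 1) with ⟨c, hc, hcb⟩ | ⟨f, hf, hfb⟩
  · exfalso
    rw [Fintype.sum_sum_type, Fintype.sum_sigma] at hcb
    have h1 := congrArg Prod.fst hcb
    have h2 := congrArg Prod.snd hcb
    simp only [a, Sum.elim_inl, Sum.elim_inr, Prod.fst_add, Prod.snd_add, Prod.fst_sum,
      Prod.snd_sum, Prod.smul_fst, Prod.smul_snd, smul_zero, Finset.sum_const_zero,
      add_zero] at h1 h2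
    have h3 : ∀ i, ∑ x : V i, c (Sum.inl ⟨i, x⟩) = 1 := by
      intro i
      have := congrFun h2 i
      simp only [Finset.sum_apply, Pi.smul_apply, Pi.single_apply, smul_eq_mul, mul_ite, mul_one,
        mul_zero, Pi.one_apply] at this
      rw [Finset.sum_eq_single i] at this
      · simpa using this
      · intro j _ hj
        simp [Ne.symm hj]
      · simp
    let t : Fin r → ℚ := ∑ s : S, c (Sum.inr s) • s.1
    have ht : t ∈ D.σ := by
      refine D.σ.sum_mem fun s _ => ?_
      exact D.σ.smul_mem (hc _ (Finset.mem_univ _)) (hSσ s.1 s.2)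
    -- The tailcone part of the combination is absorbed into the summand of index `0`.
    let y : Fin (m + 1) → (Fin r → ℚ) := fun i =>
      ∑ x : V i, c (Sum.inl ⟨i, x⟩) • x.1 + if i = 0 then t else 0
    refine D.not_sum_eq_zero y (fun i => ?_) ?_
    · rw [hV]
      refine ⟨_, ?_, _, ?_, rfl⟩
      · exact (convex_convexHull ℚ _).sum_mem (fun x _ => hc _ (Finset.mem_univ _)) (h3 i)
          fun x _ => subset_convexHull ℚ _ x.2
      · show (if i = 0 then t else 0) ∈ D.σ
        split_ifs
        · exact ht
        · exact D.σ.zero_mem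
    · simp only [y, Finset.sum_add_distrib, Finset.sum_ite_eq', Finset.mem_univ, if_true]
      exact h1
  · have hs : ∀ s ∈ D.σ, 0 ≤ f (s, 0) := by
      intro s hs
      rw [← hS] at hs
      induction hs using Submodule.span_induction with
      | mem s hs => exact hf (Sum.inr ⟨s, hs⟩) (Finset.mem_univ _)
      | zero => exact (map_zero f).ge
      | add x y _ _ hx hy =>
        have : ((x + y, 0) : (Fin r → ℚ) × (Fin (m + 1) → ℚ)) = (x, 0) + (y, 0) := by simp
        rw [this, map_add]
        exact add_nonneg hx hy
      | smul q x _ hx =>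
        have : ((q • x, 0) : (Fin r → ℚ) × (Fin (m + 1) → ℚ)) = (q : ℚ) • (x, 0) := by
          simp
        rw [this, map_smul]
        exact mul_nonneg q.2 hx
    refine ⟨f, hs, fun i x hx => ?_, hfb⟩
    rw [hV] at hx
    obtain ⟨z, hz, s, hs', rfl⟩ := hx
    have h1 : ((z + s, Pi.single i 1) : (Fin r → ℚ) × (Fin (m + 1) → ℚ)) =
        (z, Pi.single i 1) + (s, 0) := by simp
    change 0 ≤ f (z + s, Pi.single i 1)
    rw [h1, map_add]
    refine add_nonneg ?_ (hs s hs')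
    have hconv : Convex ℚ {z : Fin r → ℚ | 0 ≤ f (z, Pi.single i 1)} := by
      intro x hx y hy p q hp hq hpq
      have : ((p • x + q • y, Pi.single i 1) : (Fin r → ℚ) × (Fin (m + 1) → ℚ)) =
          p • (x, Pi.single i 1) + q • (y, Pi.single i 1) := by
        simp only [Prod.smul_mk, Prod.mk_add_mk, ← add_smul, hpq, one_smul]
      rw [Set.mem_ofPred_eq] at hx hy ⊢
      rw [this, map_add, map_smul, map_smul]
      exact add_nonneg (mul_nonneg hp hx) (mul_nonneg hq hy)
    exact convexHull_min (fun z hz => hf (Sum.inl ⟨i, z, hz⟩) (Finset.mem_univ _)) hconv hz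

/-- The polyhedron `P` contains lattice points. -/
theorem latticeP_nonempty : D.latticeP.Nonempty := by
  classical
  obtain ⟨f, h1, h2, h3⟩ := D.exists_separating
  let α : Fin r → ℚ := fun k => f (Pi.single k 1, 0)
  let β : Fin (m + 1) → ℚ := fun i => f (0, Pi.single i 1)
  have hf : ∀ x y, f (x, y) = ∑ k, α k * x k + ∑ i, β i * y i := by
    intro x y
    have hx : ((x, y) : (Fin r → ℚ) × (Fin (m + 1) → ℚ)) =
        ∑ k, x k • (Pi.single k 1, 0) + ∑ i, y i • (0, Pi.single i 1) := by
      ext k <;> simp [Prod.fst_sum, Prod.snd_sum, Finset.sum_apply, Pi.single_apply]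
    rw [hx, map_add, map_sum, map_sum]
    simp only [map_smul, smul_eq_mul, α, β, mul_comm]
  obtain ⟨N, hN⟩ := IsLocalization.exist_integer_multiples_of_finset (nonZeroDivisors ℤ)
    (Finset.univ.image α ∪ Finset.univ.image β)
  -- The common denominator `N` is only known to be nonzero; its square is positive, so scaling by
  -- it preserves the inequalities.
  have hα : ∀ k, ∃ n : ℤ, (n : ℚ) = ((N : ℤ) : ℚ) ^ 2 * α k := by
    intro k
    obtain ⟨n, hn⟩ := hN (α k) (by simp)
    refine ⟨N * n, ?_⟩
    have : (n : ℚ) = (N : ℤ) * α k := by simpa using hn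
    push_cast
    rw [this]; ring
  have hβ : ∀ k, ∃ n : ℤ, (n : ℚ) = ((N : ℤ) : ℚ) ^ 2 * β k := by
    intro k
    obtain ⟨n, hn⟩ := hN (β k) (by simp)
    refine ⟨N * n, ?_⟩
    have : (n : ℚ) = (N : ℤ) * β k := by simpa using hn
    push_cast
    rw [this]; ring
  choose u hu using hα
  choose v hv using hβ
  have hN0 : (0 : ℚ) < ((N : ℤ) : ℚ) ^ 2 := by
    have : ((N : ℤ) : ℚ) ≠ 0 := by exact_mod_cast nonZeroDivisors.coe_ne_zero N
    positivity
  have hpair : ∀ x y, ((N : ℤ) : ℚ) ^ 2 * f (x, y) = pair u x + ∑ i, (v i : ℚ) * y i := by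
    intro x y
    simp only [hf, pair, hu, hv, mul_add, Finset.mul_sum, mul_assoc]
  have hdual : D.InDual u := by
    intro x hx
    have := mul_nonneg hN0.le (h1 x hx)
    rw [hpair] at this
    simpa using this
  have hΔ : ∀ i, ∀ x ∈ D.Δ i, ((-v i : ℤ) : ℚ) ≤ pair u x := by
    intro i x hx
    have := mul_nonneg hN0.le (h2 i x hx)
    rw [hpair] at this
    simp only [Pi.single_apply, mul_ite, mul_one, mul_zero, Finset.sum_ite_eq', Finset.mem_univ,
      if_true] at this
    push_cast
    linarith
  have hsum : ∑ i, v i < 0 := by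
    have := mul_neg_of_pos_of_neg hN0 h3
    rw [hpair, pair_zero] at this
    simp only [Pi.one_apply, mul_one, zero_add] at this
    exact_mod_cast this
  refine ⟨(u, fun j => v j.succ), D.mem_latticeP_iff.2 ⟨hdual, fun j => hΔ j.succ, fun x hx => ?_⟩⟩
  refine le_trans ?_ (hΔ 0 x hx)
  rw [Fin.sum_univ_succ] at hsum
  -- A negative integer is at most `-1`; this is the `-1` in the definition of `P`.
  have : ∑ j : Fin m, v j.succ + 1 ≤ -v 0 := by omega
  exact_mod_cast this

end PolyhedralData

/-! ### Linear forms, homogenization and dehomogenization. -/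

section AffineForms

variable {K : Type*} [Field K] {m : ℕ}

/-- The exponents `0, e_1, …, e_m` of a dehomogenized linear form. -/
def unitExp : Fin (m + 1) → (Fin m → ℤ) := Fin.cons 0 fun j => Pi.single j 1

theorem unitExp_injective : Function.Injective (unitExp (m := m)) := by
  intro i j h
  induction i using Fin.cases with
  | zero =>
    induction j using Fin.cases with
    | zero => rfl
    | succ j => simpa [unitExp] using congrFun h j
  | succ i =>
    induction j using Fin.cases with
    | zero => simpa [unitExp] using congrFun h i
    | succ j =>
      have := congrFun h i
      by_cases hij : i = j
      · rw [hij]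
      · simp [unitExp, hij] at this

/-- The dehomogenization of a linear form. -/
def affineForm : (Fin (m + 1) → K) →ₗ[K] Laurent K (Fin m) where
  toFun a := ∑ k, AddMonoidAlgebra.single (unitExp k) (a k)
  map_add' a b := by simp [AddMonoidAlgebra.single_add, Finset.sum_add_distrib]
  map_smul' c a := by simp [Finset.smul_sum, AddMonoidAlgebra.smul_single]

theorem affineForm_apply (a : Fin (m + 1) → K) :
    affineForm a = ∑ k, AddMonoidAlgebra.single (unitExp k) (a k) := rfl

theorem isDehomogenizedLinear_iff {g : Laurent K (Fin m)} :
    IsDehomogenizedLinear g ↔ ∃ a, g = affineForm a := by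
  constructor
  · rintro ⟨a₀, a, rfl⟩
    refine ⟨Fin.cons a₀ a, ?_⟩
    rw [affineForm_apply, Fin.sum_univ_succ]
    simp [unitExp]
  · rintro ⟨a, rfl⟩
    refine ⟨a 0, fun j => a j.succ, ?_⟩
    rw [affineForm_apply, Fin.sum_univ_succ]
    simp [unitExp]

theorem affineForm_coeff (a : Fin (m + 1) → K) (k : Fin (m + 1)) :
    (affineForm a).coeff (unitExp k) = a k := by
  classical
  simp [affineForm_apply, AddMonoidAlgebra.coeff_sum, Finsupp.finsetSum_apply,
    Finsupp.single_apply, unitExp_injective.eq_iff]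

theorem exists_of_affineForm_coeff_ne_zero {a : Fin (m + 1) → K} {α : Fin m → ℤ}
    (h : (affineForm a).coeff α ≠ 0) : ∃ k, α = unitExp k ∧ a k ≠ 0 := by
  classical
  have h1 : ∃ k, α = unitExp k := by
    by_contra! hne
    apply h
    simp [affineForm_apply, AddMonoidAlgebra.coeff_sum, Finsupp.finsetSum_apply,
      fun k => (hne k).symm]
  obtain ⟨k, rfl⟩ := h1
  exact ⟨k, rfl, by rwa [affineForm_coeff] at h⟩

theorem weightHom_unitExp (w : Fin (m + 1) → ℝ) (k : Fin (m + 1)) :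
    weightHom (fun j => w j.succ - w 0) (unitExp k) = w k - w 0 := by
  rw [weightHom_apply]
  induction k using Fin.cases with
  | zero => simp [weight, unitExp]
  | succ k => simp [weight, unitExp, Pi.single_apply]

/-- Evaluation of Laurent polynomials at units of a `K`-algebra. -/
def evalUnits {ι E : Type*} [Fintype ι] [CommRing E] [Algebra K E] (x : ι → Eˣ) :
    Laurent K ι →ₐ[K] E :=
  AddMonoidAlgebra.lift K E (ι → ℤ)
    { toFun := fun α => ((∏ i, x i ^ (α.toAdd i) : Eˣ) : E)
      map_one' := by simp
      map_mul' := fun α β => by simp [zpow_add, Finset.prod_mul_distrib] }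

theorem evalUnits_single {ι E : Type*} [Fintype ι] [CommRing E] [Algebra K E] (x : ι → Eˣ)
    (α : ι → ℤ) (c : K) :
    evalUnits x (AddMonoidAlgebra.single α c) = c • ((∏ i, x i ^ α i : Eˣ) : E) := by
  simp [evalUnits]

theorem evalUnits_eq_evalTorus {ι : Type*} [Fintype ι] (x : ι → Kˣ) (f : Laurent K ι) :
    evalUnits x f = evalTorus x f := rfl

/-- The exponent of the homogenization of `z^v`, multiplied by `y^a`. -/
def homogExp (a : Fin (m + 1) → ℤ) (v : Fin m → ℤ) : Fin (m + 1) →₀ ℕ :=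
  Finsupp.equivFunOnFinite.symm fun i => (PolyhedralData.extend v i + a i).toNat

/-- The homogenization of `f`, multiplied by `y^a`. -/
def homogenization (a : Fin (m + 1) → ℤ) (f : Laurent K (Fin m)) : MvPolynomial (Fin (m + 1)) K :=
  ∑ v ∈ f.coeff.support, f.coeff v • MvPolynomial.monomial (homogExp a v) 1

theorem sum_extend (v : Fin m → ℤ) : ∑ i, PolyhedralData.extend v i = 0 := by
  rw [Fin.sum_univ_succ]
  simp [PolyhedralData.extend]

theorem degree_homogExp {a : Fin (m + 1) → ℤ} {v : Fin m → ℤ}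
    (h : ∀ i, -PolyhedralData.extend v i ≤ a i) : ((homogExp a v).degree : ℤ) = ∑ i, a i := by
  rw [Finsupp.degree_eq_sum]
  push_cast
  have : ∀ i, ((homogExp a v i : ℕ) : ℤ) = PolyhedralData.extend v i + a i := by
    intro i
    simp only [homogExp, Finsupp.coe_equivFunOnFinite_symm]
    rw [Int.toNat_of_nonneg]
    linarith [h i]
  simp only [this, Finset.sum_add_distrib, sum_extend, zero_add]

theorem laurent_eq_sum {A : Type*} (f : AddMonoidAlgebra K A) :
    f = ∑ v ∈ f.coeff.support, f.coeff v • AddMonoidAlgebra.single v (1 : K) := by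
  conv_lhs => rw [← AddMonoidAlgebra.sum_coeff_single f]
  rw [Finsupp.sum]
  simp [AddMonoidAlgebra.smul_single]

/-- The hypothesis makes every exponent `v_i + a_i` nonnegative, so `toNat` loses nothing. The
exponents of each `z^v` in the `y_i` add up to zero, hence the single factor `y^a`. -/
theorem aeval_homogenization {E : Type*} [CommRing E] [Algebra K E] (y : Fin (m + 1) → Eˣ)
    {a : Fin (m + 1) → ℤ} {f : Laurent K (Fin m)}
    (h : ∀ v, f.coeff v ≠ 0 → ∀ i, -PolyhedralData.extend v i ≤ a i) :
    MvPolynomial.aeval (fun i => (y i : E)) (homogenization a f) =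
      ((∏ i, y i ^ a i : Eˣ) : E) * evalUnits (fun j => y j.succ / y 0) f := by
  conv_rhs => rw [laurent_eq_sum f]
  rw [homogenization, map_sum, map_sum, Finset.mul_sum]
  refine Finset.sum_congr rfl fun v hv => ?_
  rw [map_smul, map_smul, mul_smul_comm]
  congr 1
  rw [evalUnits_single, one_smul, MvPolynomial.aeval_monomial, map_one, one_mul,
    Finsupp.prod_fintype _ _ (by simp), ← Units.val_mul]
  have h1 : ∀ i, (y i : E) ^ (homogExp a v i) =
      ((y i ^ (PolyhedralData.extend v i + a i) : Eˣ) : E) := by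
    intro i
    have := h v (Finsupp.mem_support_iff.1 hv) i
    rw [← Units.val_pow_eq_pow_val, ← zpow_natCast]
    congr 2
    simp only [homogExp, Finsupp.coe_equivFunOnFinite_symm]
    rw [Int.toNat_of_nonneg]
    linarith
  simp only [h1]
  rw [← Units.coe_prod]
  congr 1
  simp only [zpow_add, Finset.prod_mul_distrib]
  rw [mul_comm]
  congr 1
  rw [Fin.prod_univ_succ]
  simp only [PolyhedralData.extend, Fin.cons_zero, Fin.cons_succ, div_zpow, Finset.prod_div_distrib]
  have hz : ∏ j, y 0 ^ v j = y 0 ^ ∑ j, v j := by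
    induction (Finset.univ : Finset (Fin m)) using Finset.induction_on with
    | empty => simp
    | insert j s hj ih => rw [Finset.prod_insert hj, Finset.sum_insert hj, zpow_add, ih]
  rw [hz, zpow_neg, div_eq_mul_inv, mul_comm]

/-- Dehomogenization of polynomials. -/
def dehomogenize : MvPolynomial (Fin (m + 1)) K →ₐ[K] Laurent K (Fin m) :=
  MvPolynomial.aeval fun k => AddMonoidAlgebra.single (unitExp k) 1

theorem dehomogenize_monomial (β : Fin (m + 1) →₀ ℕ) (c : K) :
    dehomogenize (MvPolynomial.monomial β c) =
      AddMonoidAlgebra.single (fun j : Fin m => (β j.succ : ℤ)) c := by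
  classical
  rw [dehomogenize, MvPolynomial.aeval_monomial, Finsupp.prod_fintype _ _ (by simp)]
  simp only [AddMonoidAlgebra.single_pow, one_pow, AddMonoidAlgebra.prod_single,
    Finset.prod_const_one, AddMonoidAlgebra.coe_algebraMap, Function.comp_apply,
    AddMonoidAlgebra.single_mul_single, zero_add, mul_one, Algebra.algebraMap_self, RingHom.id_apply]
  congr 1
  ext j
  simp [Fin.sum_univ_succ, unitExp, Finset.sum_apply, Pi.single_apply]

theorem dehomogenize_homogenization {a : Fin (m + 1) → ℤ} {f : Laurent K (Fin m)}
    (h : ∀ v, f.coeff v ≠ 0 → ∀ i, -PolyhedralData.extend v i ≤ a i) :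
    AddMonoidAlgebra.single (fun j : Fin m => -a j.succ) 1 * dehomogenize (homogenization a f) =
      f := by
  conv_rhs => rw [laurent_eq_sum f]
  rw [homogenization, map_sum, Finset.mul_sum]
  refine Finset.sum_congr rfl fun v hv => ?_
  rw [map_smul, mul_smul_comm, dehomogenize_monomial, AddMonoidAlgebra.single_mul_single, mul_one]
  congr 2
  ext j
  have := h v (Finsupp.mem_support_iff.1 hv) j.succ
  simp only [Pi.add_apply, homogExp, Finsupp.coe_equivFunOnFinite_symm]
  rw [Int.toNat_of_nonneg (by linarith)]
  simp [PolyhedralData.extend]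

/-- The linear form with given coefficients. -/
def linearForm : (Fin (m + 1) → K) →ₗ[K] MvPolynomial (Fin (m + 1)) K where
  toFun a := ∑ k, a k • MvPolynomial.X k
  map_add' a b := by simp [add_smul, Finset.sum_add_distrib]
  map_smul' c a := by simp [Finset.smul_sum, smul_smul]

theorem linearForm_apply (a : Fin (m + 1) → K) :
    linearForm a = ∑ k, a k • MvPolynomial.X k := rfl

theorem linearForm_single (k : Fin (m + 1)) :
    linearForm (Pi.single k (1 : K)) = MvPolynomial.X k := by
  classical
  rw [linearForm_apply, Finset.sum_eq_single k]
  · simp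
  · intro j _ hj
    simp [hj]
  · simp

theorem dehomogenize_linearForm (a : Fin (m + 1) → K) :
    dehomogenize (linearForm a) = affineForm a := by
  rw [linearForm_apply, map_sum, affineForm_apply]
  refine Finset.sum_congr rfl fun k _ => ?_
  rw [map_smul, dehomogenize, MvPolynomial.aeval_X, AddMonoidAlgebra.smul_single, smul_eq_mul,
    mul_one]

end AffineForms

/-! ### The homogeneous ideal of a line. -/

namespace TorusLine

variable {K : Type*} [Field K] {m : ℕ} (L : TorusLine K m)

/-- The linear forms vanishing on `L`. -/
def relations : Submodule K (Fin (m + 1) → K) where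
  carrier := {a | a ⬝ᵥ L.p = 0 ∧ a ⬝ᵥ L.q = 0}
  zero_mem' := by simp
  add_mem' := by
    rintro a b ⟨h1, h2⟩ ⟨h3, h4⟩
    exact ⟨by rw [add_dotProduct, h1, h3, add_zero], by rw [add_dotProduct, h2, h4, add_zero]⟩
  smul_mem' := by
    rintro c a ⟨h1, h2⟩
    exact ⟨by rw [smul_dotProduct, h1, smul_zero], by rw [smul_dotProduct, h2, smul_zero]⟩

theorem exists_minor_ne_zero : ∃ i j, L.p i * L.q j - L.p j * L.q i ≠ 0 := by
  by_contra! h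
  have hind := LinearIndependent.pair_iff.1 L.independent
  have hp : L.p ≠ 0 := by
    intro h0
    have := hind 1 0 (by simp [h0])
    exact one_ne_zero this.1
  obtain ⟨i, hi⟩ := Function.ne_iff.1 hp
  refine hi (neg_eq_zero.1 (hind (L.q i) (-L.p i) ?_).2)
  ext j
  have := h i j
  simp only [Pi.add_apply, Pi.smul_apply, smul_eq_mul, Pi.zero_apply]
  linear_combination -this

/-- The span of the products of monomials with linear forms vanishing on `L`, in degree `d`. -/
def relationMultiples (d : ℕ) : Submodule K (MvPolynomial (Fin (m + 1)) K) :=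
  Submodule.span K {F | ∃ l ∈ L.relations, ∃ β : Fin (m + 1) →₀ ℕ, β.degree + 1 = d ∧
    F = MvPolynomial.monomial β 1 * linearForm l}

theorem X_mul_mem_relationMultiples {d : ℕ} {F : MvPolynomial (Fin (m + 1)) K}
    (hF : F ∈ L.relationMultiples d) (k : Fin (m + 1)) :
    MvPolynomial.X k * F ∈ L.relationMultiples (d + 1) := by
  induction hF using Submodule.span_induction with
  | mem F hF =>
    obtain ⟨l, hl, β, hβ, rfl⟩ := hF
    refine Submodule.subset_span ⟨l, hl, Finsupp.single k 1 + β, ?_, ?_⟩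
    · rw [map_add, Finsupp.degree_single]; omega
    · rw [MvPolynomial.X, ← mul_assoc, MvPolynomial.monomial_mul, one_mul]
  | zero => rw [mul_zero]; exact Submodule.zero_mem _
  | add F G _ _ hF hG => rw [mul_add]; exact Submodule.add_mem _ hF hG
  | smul c F _ hF => rw [mul_smul_comm]; exact Submodule.smul_mem _ _ hF

theorem linearForm_mul_mem_relationMultiples {d : ℕ} {F : MvPolynomial (Fin (m + 1)) K}
    (hF : F ∈ L.relationMultiples d) (a : Fin (m + 1) → K) :
    linearForm a * F ∈ L.relationMultiples (d + 1) := by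
  rw [linearForm_apply, Finset.sum_mul]
  refine Submodule.sum_mem _ fun k _ => ?_
  rw [smul_mul_assoc]
  exact Submodule.smul_mem _ _ (L.X_mul_mem_relationMultiples hF k)

/-- Substituting for each `y_k` its expression in two linear coordinates on `L` changes a form only
by multiples of linear relations, in the same degree. The result is a binary form in these
coordinates, which is zero if the form vanishes on `L`. -/
theorem mem_relationMultiples {a : Fin (m + 1) → ℤ} {f : Laurent K (Fin m)}
    (h : ∀ v, f.coeff v ≠ 0 → ∀ i, -PolyhedralData.extend v i ≤ a i)
    (h0 : MvPolynomial.aeval L.coord (homogenization a f) = 0) :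
    homogenization a f ∈ L.relationMultiples (∑ i, a i).toNat := by
  classical
  obtain ⟨i, j, hij⟩ := L.exists_minor_ne_zero
  obtain ⟨δ, hδ⟩ : ∃ δ, δ * (L.p i * L.q j - L.p j * L.q i) = 1 := ⟨_, inv_mul_cancel₀ hij⟩
  -- By Cramer's rule, `s` and `t` are linear forms dual to `p` and `q`, supported on the columns of
  -- a nonzero minor.
  let s : Fin (m + 1) → K := Pi.single i (δ * L.q j) - Pi.single j (δ * L.q i)
  let t : Fin (m + 1) → K := Pi.single j (δ * L.p i) - Pi.single i (δ * L.p j)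
  have hsp : s ⬝ᵥ L.p = 1 := by
    simp only [s, sub_dotProduct, single_dotProduct]; linear_combination hδ
  have hsq : s ⬝ᵥ L.q = 0 := by
    simp only [s, sub_dotProduct, single_dotProduct]; ring
  have htp : t ⬝ᵥ L.p = 0 := by
    simp only [t, sub_dotProduct, single_dotProduct]; ring
  have htq : t ⬝ᵥ L.q = 1 := by
    simp only [t, sub_dotProduct, single_dotProduct]; linear_combination hδ
  let θ : MvPolynomial (Fin (m + 1)) K →ₐ[K] MvPolynomial (Fin (m + 1)) K :=
    MvPolynomial.aeval fun k => linearForm (L.p k • s + L.q k • t)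
  have hmon : ∀ (n : ℕ) (β : Fin (m + 1) →₀ ℕ), β.degree = n →
      MvPolynomial.monomial β (1 : K) - θ (MvPolynomial.monomial β 1) ∈
        L.relationMultiples n := by
    intro n
    induction n with
    | zero =>
      intro β hβ
      rw [Finsupp.degree_eq_zero_iff] at hβ
      subst hβ
      rw [show MvPolynomial.monomial (0 : Fin (m + 1) →₀ ℕ) (1 : K) = 1 from rfl, map_one, sub_self]
      exact Submodule.zero_mem _
    | succ n ih =>
      intro β hβ
      obtain ⟨k, hk⟩ : ∃ k, β k ≠ 0 := by
        by_contra! hk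
        have : β = 0 := Finsupp.ext hk
        simp [this] at hβ
      obtain ⟨γ, rfl⟩ : ∃ γ, β = Finsupp.single k 1 + γ :=
        ⟨β - Finsupp.single k 1, (add_tsub_cancel_of_le
          (by rw [Finsupp.single_le_iff]; omega)).symm⟩
      have hγ : γ.degree = n := by
        rw [map_add, Finsupp.degree_single] at hβ; omega
      have hθ : θ (MvPolynomial.X k) = linearForm (L.p k • s + L.q k • t) := by simp [θ]
      have hmul : MvPolynomial.monomial (Finsupp.single k 1 + γ) (1 : K) =
          MvPolynomial.X k * MvPolynomial.monomial γ 1 := by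
        rw [MvPolynomial.X, MvPolynomial.monomial_mul, one_mul]
      -- The first summand contains `y_k - (p_k s + q_k t)`, a linear form vanishing on `L`; the
      -- second is covered by induction on the degree.
      have hsplit : MvPolynomial.X k * MvPolynomial.monomial γ 1 -
          θ (MvPolynomial.X k) * θ (MvPolynomial.monomial γ 1) =
          MvPolynomial.monomial γ 1 *
            linearForm (Pi.single k 1 - (L.p k • s + L.q k • t)) +
          linearForm (L.p k • s + L.q k • t) *
            (MvPolynomial.monomial γ 1 - θ (MvPolynomial.monomial γ 1)) := by
        rw [map_sub, linearForm_single, hθ]; ring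
      rw [hmul, map_mul, hsplit]
      refine Submodule.add_mem _ (Submodule.subset_span ⟨_, ?_, γ, by rw [hγ], rfl⟩)
        (L.linearForm_mul_mem_relationMultiples (ih γ hγ) _)
      constructor
      · rw [sub_dotProduct, add_dotProduct, smul_dotProduct, smul_dotProduct, hsp, htp,
          single_dotProduct]
        simp
      · rw [sub_dotProduct, add_dotProduct, smul_dotProduct, smul_dotProduct, hsq, htq,
          single_dotProduct]
        simp
  have hdeg : ∀ v ∈ f.coeff.support, (homogExp a v).degree = (∑ i, a i).toNat := by
    intro v hv
    rw [← degree_homogExp (h v (Finsupp.mem_support_iff.1 hv)), Int.toNat_natCast]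
  have hθ0 : θ (homogenization a f) = 0 := by
    let R := MvPolynomial (Fin (m + 1)) K
    let E := FractionRing R
    have hS : algebraMap R E (linearForm s) ≠ 0 := by
      intro hS
      have h1 : linearForm s = 0 := (IsFractionRing.injective R E) (by rw [hS, map_zero])
      have h2 := congrArg (MvPolynomial.eval L.p) h1
      rw [linearForm_apply, map_sum, map_zero] at h2
      simp only [MvPolynomial.smul_eval, MvPolynomial.eval_X] at h2
      exact one_ne_zero (hsp.symm.trans h2)
    apply IsFractionRing.injective R E
    rw [map_zero]
    -- In the fraction field `p_k s + q_k t = s · (p_k + q_k τ)`. The form being homogeneous, a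
    -- power of `s` factors out and its pullback to `L`, evaluated at `τ`, remains.
    let τ : E := algebraMap R E (linearForm t) / algebraMap R E (linearForm s)
    have hz : ∀ k, algebraMap R E (linearForm (L.p k • s + L.q k • t)) =
        algebraMap R E (linearForm s) * Polynomial.aeval τ (L.coord k) := by
      intro k
      rw [map_add, map_smul, map_smul, map_add, Algebra.smul_def, Algebra.smul_def, map_mul,
        map_mul, ← IsScalarTower.algebraMap_apply, ← IsScalarTower.algebraMap_apply]
      simp only [coord, map_add, map_mul, Polynomial.aeval_C, Polynomial.aeval_X, τ]
      rw [mul_add, mul_left_comm, mul_div_cancel₀ _ hS, mul_comm]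
    have h1 : algebraMap R E (θ (homogenization a f)) =
        algebraMap R E (linearForm s) ^ (∑ i, a i).toNat *
          Polynomial.aeval τ (MvPolynomial.aeval L.coord (homogenization a f)) := by
      rw [homogenization]
      simp only [map_sum, Finset.mul_sum]
      refine Finset.sum_congr rfl fun v hv => ?_
      simp only [map_smul]
      rw [Algebra.smul_def, map_mul, Algebra.smul_def, mul_left_comm,
        ← IsScalarTower.algebraMap_apply]
      congr 1
      simp only [θ, MvPolynomial.aeval_monomial, map_one, one_mul, map_finsuppProd, map_pow]
      rw [Finsupp.prod_fintype _ _ (by simp), Finsupp.prod_fintype _ _ (by simp)]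
      simp only [hz, mul_pow]
      rw [Finset.prod_mul_distrib, Finset.prod_pow_eq_pow_sum, ← Finsupp.degree_eq_sum, hdeg v hv]
    rw [h1, h0, map_zero, mul_zero]
  rw [← sub_zero (homogenization a f), ← hθ0]
  rw [homogenization, map_sum, ← Finset.sum_sub_distrib]
  refine Submodule.sum_mem _ fun v hv => ?_
  rw [map_smul, ← smul_sub]
  exact Submodule.smul_mem _ _ (hmon _ _ (hdeg v hv))

end TorusLine

/-! ### The generic point of the line, and tropical bases of linear forms. -/

namespace TorusLine

variable {K : Type*} [Field K] {m : ℕ} (L : TorusLine K m)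

/-- The homogeneous coordinates on `L`, as units of the function field. -/
def coordUnit (i : Fin (m + 1)) : (RatFunc K)ˣ :=
  Units.mk0 (algebraMap K[X] (RatFunc K) (L.coord i)) (by simpa using L.coord_ne_zero i)

/-- The generic point of `L°`. -/
def genericPoint (j : Fin m) : (RatFunc K)ˣ := L.coordUnit j.succ / L.coordUnit 0

theorem evalUnits_genericPoint_single (v : Fin m → ℤ) (c : K) :
    evalUnits L.genericPoint (AddMonoidAlgebra.single v c) = c • L.restrictMonomial v := by
  rw [evalUnits_single]
  congr 1
  simp [genericPoint, coordUnit, restrictMonomial]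

theorem algebraMap_aeval_coord (F : MvPolynomial (Fin (m + 1)) K) :
    MvPolynomial.aeval (fun i => (L.coordUnit i : RatFunc K)) F =
      algebraMap K[X] (RatFunc K) (MvPolynomial.aeval L.coord F) := by
  rw [← MvPolynomial.aeval_algebraMap_apply]
  rfl

/-- The two values differ by the unit `∏ y_i^{a_i}` of the function field. -/
theorem evalUnits_genericPoint_eq_zero_iff {a : Fin (m + 1) → ℤ} {f : Laurent K (Fin m)}
    (h : ∀ v, f.coeff v ≠ 0 → ∀ i, -PolyhedralData.extend v i ≤ a i) :
    evalUnits L.genericPoint f = 0 ↔ MvPolynomial.aeval L.coord (homogenization a f) = 0 := by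
  have h1 := aeval_homogenization L.coordUnit h
  rw [algebraMap_aeval_coord] at h1
  rw [← (IsFractionRing.injective K[X] (RatFunc K)).eq_iff, map_zero, h1]
  exact (Units.mul_right_eq_zero _).symm

/-- A Laurent polynomial vanishing on `L` is a combination of multiples of linear forms vanishing
on `L` by monomials, where the multiples satisfy the same bounds on the exponents. -/
theorem mem_span_of_evalUnits_genericPoint {a : Fin (m + 1) → ℤ} {f : Laurent K (Fin m)}
    (h : ∀ v, f.coeff v ≠ 0 → ∀ i, -PolyhedralData.extend v i ≤ a i)
    (h0 : evalUnits L.genericPoint f = 0) :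
    f ∈ Submodule.span K {g | ∃ l ∈ L.relations, ∃ v : Fin m → ℤ, (∀ j, -v j ≤ a j.succ) ∧
      ∑ j, v j + 1 ≤ a 0 ∧ g = affineForm l * AddMonoidAlgebra.single v 1} := by
  have h1 := L.mem_relationMultiples h ((L.evalUnits_genericPoint_eq_zero_iff h).1 h0)
  rw [← dehomogenize_homogenization h]
  refine Submodule.span_induction (p := fun F _ =>
    AddMonoidAlgebra.single (fun j : Fin m => -a j.succ) 1 * dehomogenize F ∈ _)
    ?_ ?_ ?_ ?_ h1
  · rintro F ⟨l, hl, β, hβ, rfl⟩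
    have hsum : ∑ i, a i = ∑ i, (β i : ℤ) + 1 := by
      rw [Finsupp.degree_eq_sum] at hβ
      have := congrArg (Nat.cast : ℕ → ℤ) hβ
      push_cast at this
      omega
    -- The multiplier `y^β` has degree one less than `∑ a_i`, so `v_1 + ⋯ + v_m + 1 = a_0 - β_0`.
    -- The bounds on `v` just say that `β` is nonnegative.
    refine Submodule.subset_span ⟨l, hl, fun j => β j.succ - a j.succ, fun j => ?_, ?_, ?_⟩
    · have : (0 : ℤ) ≤ β j.succ := by positivity
      linarith
    · rw [Fin.sum_univ_succ, Fin.sum_univ_succ] at hsum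
      rw [Finset.sum_sub_distrib]
      have : (0 : ℤ) ≤ β 0 := by positivity
      linarith
    · rw [map_mul, dehomogenize_monomial, dehomogenize_linearForm, ← mul_assoc,
        AddMonoidAlgebra.single_mul_single, mul_one, mul_comm]
      congr 2
      ext j
      simp; ring
  · rw [map_zero, mul_zero]; exact Submodule.zero_mem _
  · intro F G _ _ hF hG
    rw [map_add, mul_add]; exact Submodule.add_mem _ hF hG
  · intro c F _ hF
    rw [map_smul, mul_smul_comm]; exact Submodule.smul_mem _ _ hF

theorem exists_bound (f : Laurent K (Fin m)) :
    ∃ a : Fin (m + 1) → ℤ, ∀ v, f.coeff v ≠ 0 → ∀ i, -PolyhedralData.extend v i ≤ a i := by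
  classical
  have : ∀ i, ∃ a : ℤ, ∀ v ∈ f.coeff.support, -PolyhedralData.extend v i ≤ a := by
    intro i
    obtain ⟨b, hb⟩ := (f.coeff.support.image fun v => -PolyhedralData.extend v i).bddAbove
    exact ⟨b, fun v hv => hb (by simpa using ⟨v, by simpa using hv, rfl⟩)⟩
  choose a ha using this
  exact ⟨a, fun v hv i => ha i v (Finsupp.mem_support_iff.2 hv)⟩

/-- Laurent polynomials vanishing at the points of `L°` vanish at the generic point. -/
theorem evalUnits_genericPoint_of_mem_torusIdeal [Infinite K] {f : Laurent K (Fin m)}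
    (hf : f ∈ torusIdeal L.torusPart) : evalUnits L.genericPoint f = 0 := by
  classical
  obtain ⟨a, ha⟩ := exists_bound f
  rw [L.evalUnits_genericPoint_eq_zero_iff ha]
  -- The product of the coordinates takes care of the parameters `τ` whose point lies outside the
  -- torus. Over an infinite field, vanishing at every `τ` is enough.
  have hprod : MvPolynomial.aeval L.coord (homogenization a f) * ∏ i, L.coord i = 0 := by
    refine Polynomial.funext fun τ => ?_
    rw [Polynomial.eval_mul, Polynomial.eval_zero, Polynomial.eval_prod]
    by_cases h0 : ∃ i, (L.coord i).eval τ = 0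
    · obtain ⟨i, hi⟩ := h0
      rw [Finset.prod_eq_zero (Finset.mem_univ i) hi, mul_zero]
    · push Not at h0
      let y : Fin (m + 1) → Kˣ := fun i => Units.mk0 _ (h0 i)
      have h1 := aeval_homogenization y ha
      have h2 : (fun j => y j.succ / y 0) ∈ L.torusPart := by
        change _ ∈ Submodule.span K {L.p, L.q}
        refine Submodule.mem_span_pair.2 ⟨((y 0)⁻¹ : Kˣ), ((y 0)⁻¹ : Kˣ) * τ, ?_⟩
        have hy : ∀ i, (y i : K) = L.p i + L.q i * τ := fun i => by simp [y, coord]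
        have hy0 : (y 0 : K) ≠ 0 := (y 0).ne_zero
        ext i
        simp only [Pi.add_apply, Pi.smul_apply, smul_eq_mul]
        have h3 : (((y 0)⁻¹ : Kˣ) : K) * L.p i + ((y 0)⁻¹ : Kˣ) * τ * L.q i =
            ((y 0)⁻¹ : Kˣ) * y i := by rw [hy i]; ring
        rw [h3]
        induction i using Fin.cases with
        | zero => simp
        | succ j => simp [div_eq_inv_mul]
      rw [evalUnits_eq_evalTorus, mem_torusIdeal.1 hf _ h2, mul_zero] at h1
      have h4 : Polynomial.eval τ (MvPolynomial.aeval L.coord (homogenization a f)) =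
          MvPolynomial.aeval (fun i => (y i : K)) (homogenization a f) := by
        rw [← Polynomial.coe_aeval_eq_eval]
        exact MvPolynomial.comp_aeval_apply (f := L.coord)
          ((Polynomial.aeval τ : K[X] →ₐ[K] K)) (homogenization a f)
      rw [h4, h1, zero_mul]
  exact (mul_eq_zero.1 hprod).resolve_right
    (Finset.prod_ne_zero_iff.2 fun i _ => L.coord_ne_zero i)

theorem evalTorus_affineForm (z : Fin m → Kˣ) (a : Fin (m + 1) → K) :
    evalTorus z (affineForm a) = a ⬝ᵥ (Fin.cons 1 fun j => (z j : K)) := by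
  classical
  rw [affineForm_apply, map_sum, dotProduct]
  refine Finset.sum_congr rfl fun k _ => ?_
  rw [evalTorus_single]
  congr 1
  induction k using Fin.cases with
  | zero => simp [unitExp]
  | succ k =>
    rw [Finset.prod_eq_single k]
    · simp [unitExp]
    · intro j _ hj
      simp [unitExp, hj]
    · simp

theorem affineForm_mem_torusIdeal {a : Fin (m + 1) → K} (ha : a ∈ L.relations) :
    affineForm a ∈ torusIdeal L.torusPart := by
  refine mem_torusIdeal.2 fun z hz => ?_
  obtain ⟨s, t, hst⟩ := Submodule.mem_span_pair.1 hz
  rw [evalTorus_affineForm, ← hst, dotProduct_add, dotProduct_smul, dotProduct_smul, ha.1, ha.2]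
  simp

/-- Vanishing at the generic point makes `∑ a_k (p_k + q_k t)` the zero polynomial; its two
coefficients are the two defining equations. -/
theorem mem_relations_of_affineForm [Infinite K] {a : Fin (m + 1) → K}
    (ha : affineForm a ∈ torusIdeal L.torusPart) : a ∈ L.relations := by
  have h1 := L.evalUnits_genericPoint_of_mem_torusIdeal ha
  have h2 : evalUnits L.genericPoint (affineForm a) * (L.coordUnit 0 : RatFunc K) =
      algebraMap K[X] (RatFunc K) (∑ k, Polynomial.C (a k) * L.coord k) := by
    rw [affineForm_apply, map_sum, map_sum, Finset.sum_mul]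
    refine Finset.sum_congr rfl fun k _ => ?_
    rw [evalUnits_genericPoint_single, map_mul, RatFunc.algebraMap_C, RatFunc.smul_eq_C_mul,
      mul_assoc]
    congr 1
    have h0 : algebraMap K[X] (RatFunc K) (L.coord 0) ≠ 0 := (L.coordUnit 0).ne_zero
    change _ * algebraMap K[X] (RatFunc K) (L.coord 0) = _
    induction k using Fin.cases with
    | zero => simp [unitExp, restrictMonomial]
    | succ k =>
      rw [restrictMonomial, Finset.prod_eq_single k]
      · simp [unitExp, h0]
      · intro j _ hj
        simp [unitExp, hj]
      · simp
  rw [h1, zero_mul] at h2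
  have h3 : ∑ k, Polynomial.C (a k) * L.coord k = 0 :=
    (IsFractionRing.injective K[X] (RatFunc K)) (by rw [← h2, map_zero])
  have h4 : Polynomial.C (a ⬝ᵥ L.p) + Polynomial.C (a ⬝ᵥ L.q) * Polynomial.X = 0 := by
    rw [← h3]
    simp only [dotProduct, map_sum, map_mul, coord, mul_add, Finset.sum_add_distrib,
      Finset.sum_mul, mul_assoc]
  constructor
  · simpa using congrArg (fun P => Polynomial.coeff P 0) h4
  · simpa using congrArg (fun P => Polynomial.coeff P 1) h4

theorem single_notMem_relations (k : Fin (m + 1)) : Pi.single k (1 : K) ∉ L.relations := by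
  rintro ⟨h1, h2⟩
  rw [single_dotProduct, one_mul] at h1 h2
  exact (L.p_ne_zero_or k).elim (· h1) (· h2)

/-- A tropical basis of `L°` consisting of linear forms spans all linear forms vanishing on `L`. -/
theorem relations_le_span [IsAlgClosed K] {G : Set (Laurent K (Fin m))}
    (hG : IsTropicalBasis L.torusPart G) (hlin : ∀ g ∈ G, IsDehomogenizedLinear g) :
    L.relations ≤ Submodule.span K {a | affineForm a ∈ G} := by
  classical
  have : Infinite K := IsAlgClosed.instInfinite
  set V := Submodule.span K {a : Fin (m + 1) → K | affineForm a ∈ G} with hV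
  have hVW : V ≤ L.relations :=
    Submodule.span_le.2 fun a ha => L.mem_relations_of_affineForm (hG.1 ha)
  obtain ⟨i, j, hij⟩ := L.exists_minor_ne_zero
  let e : Fin (m + 1) → (Fin (m + 1) → K) := fun k => Pi.single k 1
  let V₁ := V ⊔ Submodule.span K {e i}
  let V₂ := V₁ ⊔ Submodule.span K {e j}
  have h12 : V₁ ≤ V₂ := le_sup_left
  by_contra hcon
  -- The minor makes `e i` and `e j` independent modulo the relations of `L`. If `V₂` were
  -- everything, a relation could have no component along them and would lie in `V`.
  obtain ⟨c, hc⟩ : ∃ c, e c ∉ V₂ := by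
    by_contra! hall
    apply hcon
    intro x hx
    have hx2 : x ∈ V₂ := by
      have : x = ∑ k, x k • e k := by
        ext l
        simp [e, Finset.sum_apply, Pi.single_apply]
      rw [this]
      exact V₂.sum_mem fun k _ => V₂.smul_mem _ (hall k)
    obtain ⟨y, hy, b, hb, rfl⟩ := Submodule.mem_sup.1 hx2
    obtain ⟨v, hv, a, ha, rfl⟩ := Submodule.mem_sup.1 hy
    obtain ⟨α, rfl⟩ := Submodule.mem_span_singleton.1 ha
    obtain ⟨β, rfl⟩ := Submodule.mem_span_singleton.1 hb
    have hv' := hVW hv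
    have h1 := hx.1
    have h2 := hx.2
    simp only [add_dotProduct, hv'.1, hv'.2, smul_dotProduct, e, single_dotProduct, one_mul,
      zero_add, smul_eq_mul] at h1 h2
    have hα : α = 0 := by
      have : α * (L.p i * L.q j - L.p j * L.q i) = 0 := by
        linear_combination L.q j * h1 - L.p j * h2
      exact (mul_eq_zero.1 this).resolve_right hij
    have hβ : β = 0 := by
      have : β * (L.p i * L.q j - L.p j * L.q i) = 0 := by
        linear_combination L.p i * h2 - L.q i * h1
      exact (mul_eq_zero.1 this).resolve_right hij
    rw [hα, hβ]
    simpa using hv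
  have hj : e j ∉ V₁ := by
    intro hj
    obtain ⟨v, hv, a, ha, hva⟩ := Submodule.mem_sup.1 hj
    obtain ⟨α, rfl⟩ := Submodule.mem_span_singleton.1 ha
    have hv' := hVW hv
    rw [eq_sub_of_add_eq hva] at hv'
    have h1 := hv'.1
    have h2 := hv'.2
    simp only [sub_dotProduct, smul_dotProduct, e, single_dotProduct, one_mul, smul_eq_mul]
      at h1 h2
    exact hij (by linear_combination L.p i * h2 - L.q i * h1)
  have hi1 : e i ∈ V₁ := le_sup_right (a := V) (Submodule.mem_span_singleton_self _)
  have hj2 : e j ∈ V₂ := le_sup_right (a := V₁) (Submodule.mem_span_singleton_self _)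
  -- The weight of the flag of flats cut out by `V₁ ≤ V₂` in the matroid of the `e k` modulo `V`.
  let w' : Fin (m + 1) → ℝ := fun k => if e k ∈ V₁ then 2 else if e k ∈ V₂ then 1 else 0
  let w : Fin m → ℝ := fun j => w' j.succ - w' 0
  have hw : ∀ k, weightHom w (unitExp k) = w' k - w' 0 := weightHom_unitExp w'
  have hwi : w' i = 2 := if_pos hi1
  have hwj : w' j = 1 := by simp only [w', if_neg hj, if_pos hj2]
  have hwc : w' c = 0 := by simp only [w', if_neg hc, if_neg fun h => hc (h12 h)]
  have hmem : w ∈ trop L.torusPart := by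
    rw [hG.2]
    refine Set.mem_iInter₂.2 fun g hg => mem_trop_hypersurface fun α hα => ?_
    obtain ⟨a, rfl⟩ := isDehomogenizedLinear_iff.1 (hlin g hg)
    obtain ⟨k, rfl, hk⟩ := exists_of_affineForm_coeff_ne_zero hα
    by_contra! hstrict
    have hlt : ∀ l, a l ≠ 0 → l ≠ k → w' k < w' l := by
      intro l hl hlk
      have := hstrict (unitExp l) (by rwa [affineForm_coeff]) (unitExp_injective.ne hlk)
      rw [hw, hw] at this
      linarith
    have haV : a ∈ V := Submodule.subset_span hg
    -- If `k` alone were minimal in the support of `a ∈ V`, then `e k` would lie in any `U`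
    -- containing `V` and the remaining `e l`. For `e k ∈ V₁` there are no heavier `l`, so `e k`
    -- would be a relation of `L`. Otherwise all other `l` have weight at least `1`, which puts `e
    -- k` in `V₂`, then weight `2`, which puts it in `V₁`.
    have key : ∀ U : Submodule K (Fin (m + 1) → K), V ≤ U →
        (∀ l, a l ≠ 0 → l ≠ k → e l ∈ U) → e k ∈ U := by
      intro U hU h
      have hsum : e k = (a k)⁻¹ • (a - ∑ l ∈ Finset.univ.erase k, a l • e l) := by
        have : ∑ l ∈ Finset.univ.erase k, a l • e l + a k • e k = a := by
          rw [Finset.sum_erase_add _ _ (Finset.mem_univ k)]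
          ext l
          simp [e, Finset.sum_apply, Pi.single_apply]
        rw [← eq_sub_of_add_eq' this, inv_smul_smul₀ hk]
      rw [hsum]
      refine U.smul_mem _ (U.sub_mem (hU haV) (U.sum_mem fun l hl => ?_))
      by_cases h0 : a l = 0
      · rw [h0, zero_smul]; exact U.zero_mem
      · exact U.smul_mem _ (h l h0 (Finset.ne_of_mem_erase hl))
    by_cases hk1 : e k ∈ V₁
    · refine L.single_notMem_relations k (hVW (key V le_rfl fun l hl hlk => ?_))
      have := hlt l hl hlk
      simp only [w', if_pos hk1] at this
      split_ifs at this <;> norm_num at this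
    · have hk2 : e k ∈ V₂ := by
        refine key V₂ (le_sup_left.trans h12) fun l hl hlk => ?_
        by_contra hl2
        have := hlt l hl hlk
        simp only [w', if_neg hl2, if_neg fun h => hl2 (h12 h)] at this
        split_ifs at this <;> norm_num at this
      refine hk1 (key V₁ le_sup_left fun l hl hlk => ?_)
      by_contra hl1
      have := hlt l hl hlk
      simp only [w', if_neg hl1, if_neg hk1, if_pos hk2] at this
      split_ifs at this <;> norm_num at this
  have hic : i ≠ c := by rintro rfl; linarith
  have hjc : j ≠ c := by rintro rfl; linarith
  -- The relation among the columns `i, j, c`, with minors as coefficients. The one at `c` is the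
  -- chosen nonzero minor, and `c` is the only index among the three of weight `0`.
  let b : Fin (m + 1) → K := (L.p j * L.q c - L.p c * L.q j) • e i -
    (L.p i * L.q c - L.p c * L.q i) • e j + (L.p i * L.q j - L.p j * L.q i) • e c
  have hb : b ∈ L.relations := by
    constructor <;>
    · simp only [b, sub_dotProduct, add_dotProduct, smul_dotProduct, e, single_dotProduct, one_mul,
        smul_eq_mul]
      ring
  have hbc : b c ≠ 0 := by
    simpa [b, e, hic.symm, hjc.symm, Pi.single_apply] using hij
  obtain ⟨β, hβ, hβc, hβw⟩ := exists_weight_le_of_mem_trop hmem (L.affineForm_mem_torusIdeal hb)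
    (α := unitExp c) (by rwa [affineForm_coeff])
  obtain ⟨k, rfl, hk⟩ := exists_of_affineForm_coeff_ne_zero hβ
  rw [hw, hw, hwc] at hβw
  have hkc : k ≠ c := by rintro rfl; exact hβc rfl
  by_cases hki : k = i
  · rw [hki] at hβw; linarith
  by_cases hkj : k = j
  · rw [hkj] at hβw; linarith
  exact hk (by simp [b, e, hki, hkj, hkc])

end TorusLine

/-! ### The grading by M. -/

section Slices

variable {K : Type*} [Field K] {r m : ℕ}

/-- The coefficient of `χ^u` in an element of `K[M × ℤ^m]`. -/
def slice (u : Fin r → ℤ) : AddMonoidAlgebra K (Char r m) →+ Laurent K (Fin m) where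
  toFun F := AddMonoidAlgebra.ofCoeff
    (F.coeff.comapDomain (fun v => (u, v)) (Prod.mk_right_injective u).injOn)
  map_zero' := by ext; simp
  map_add' F G := by ext; simp

theorem slice_coeff (u : Fin r → ℤ) (F : AddMonoidAlgebra K (Char r m)) (v : Fin m → ℤ) :
    (slice u F).coeff v = F.coeff (u, v) := rfl

open Classical in
theorem slice_single (u : Fin r → ℤ) (d : Char r m) (c : K) :
    slice u (AddMonoidAlgebra.single d c) =
      if d.1 = u then AddMonoidAlgebra.single d.2 c else 0 := by
  obtain ⟨u', v'⟩ := d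
  ext v
  rw [slice_coeff, AddMonoidAlgebra.coeff_single, Finsupp.single_apply]
  by_cases h : u' = u
  · simp [h, Finsupp.single_apply]
  · simp [h]

theorem twist_zero (u : Fin r → ℤ) : twist u (0 : Laurent K (Fin m)) = 0 :=
  AddMonoidAlgebra.mapDomain_zero _

theorem twist_add (u : Fin r → ℤ) (f g : Laurent K (Fin m)) :
    twist u (f + g) = twist u f + twist u g := AddMonoidAlgebra.mapDomain_add ..

theorem twist_single (u : Fin r → ℤ) (v : Fin m → ℤ) (c : K) :
    twist u (AddMonoidAlgebra.single v c) = AddMonoidAlgebra.single (u, v) c :=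
  AddMonoidAlgebra.mapDomain_single

theorem twist_smul (u : Fin r → ℤ) (c : K) (f : Laurent K (Fin m)) :
    twist u (c • f) = c • twist u f := by
  induction f using AddMonoidAlgebra.induction_linear with
  | zero => simp [twist_zero]
  | add f g hf hg => rw [smul_add, twist_add, twist_add, smul_add, hf, hg]
  | single v k => simp [AddMonoidAlgebra.smul_single, twist_single]

theorem slice_twist (u : Fin r → ℤ) (f : Laurent K (Fin m)) : slice u (twist u f) = f := by
  induction f using AddMonoidAlgebra.induction_linear with
  | zero => simp [twist_zero]
  | add f g hf hg => rw [twist_add, map_add, hf, hg]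
  | single v k => simp [twist_single, slice_single]

theorem slice_twist_of_ne {u u' : Fin r → ℤ} (h : u' ≠ u) (f : Laurent K (Fin m)) :
    slice u (twist u' f) = 0 := by
  induction f using AddMonoidAlgebra.induction_linear with
  | zero => simp [twist_zero]
  | add f g hf hg => rw [twist_add, map_add, hf, hg, add_zero]
  | single v k => simp [twist_single, slice_single, h]

theorem twist_coeff (u : Fin r → ℤ) (f : Laurent K (Fin m)) (v : Fin m → ℤ) :
    (twist u f).coeff (u, v) = f.coeff v := by
  rw [← slice_coeff, slice_twist]

theorem fst_eq_of_twist_coeff_ne_zero {u : Fin r → ℤ} {f : Laurent K (Fin m)} {d : Char r m}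
    (h : (twist u f).coeff d ≠ 0) : d.1 = u := by
  by_contra hne
  obtain ⟨u', v⟩ := d
  rw [← slice_coeff, slice_twist_of_ne (Ne.symm hne)] at h
  exact h rfl

theorem single_mul_twist (d : Char r m) (c : K) (u : Fin r → ℤ) (f : Laurent K (Fin m)) :
    AddMonoidAlgebra.single d c * twist u f =
      twist (d.1 + u) (AddMonoidAlgebra.single d.2 c * f) := by
  induction f using AddMonoidAlgebra.induction_linear with
  | zero => simp [twist_zero]
  | add f g hf hg => rw [twist_add, mul_add, mul_add, twist_add, hf, hg]
  | single v k => simp [twist_single, AddMonoidAlgebra.single_mul_single]; rfl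

theorem sum_twist_slice (F : AddMonoidAlgebra K (Char r m)) (s : Finset (Fin r → ℤ))
    (hs : ∀ d, F.coeff d ≠ 0 → d.1 ∈ s) : F = ∑ u ∈ s, twist u (slice u F) := by
  classical
  ext ⟨u, v⟩
  rw [AddMonoidAlgebra.coeff_sum, Finsupp.finsetSum_apply]
  by_cases hu : u ∈ s
  · rw [Finset.sum_eq_single u, twist_coeff, slice_coeff]
    · intro u' _ hne
      by_contra h
      exact hne (fst_eq_of_twist_coeff_ne_zero h).symm
    · exact fun h => absurd hu h
  · have h0 : F.coeff (u, v) = 0 := by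
      by_contra h
      exact hu (hs _ h)
    rw [h0]
    refine (Finset.sum_eq_zero fun u' hu' => ?_).symm
    by_contra h
    have h1 : u = u' := fst_eq_of_twist_coeff_ne_zero h
    exact hu (by rwa [h1])

end Slices

/-! ### Generators of the kernel of restriction to the line. -/

section ConeRing

variable {K : Type*} [Field K] {r m : ℕ} (D : PolyhedralData r m) (L : TorusLine K m)

theorem coneRingIncl_single (d : D.dualMonoid) (c : K) :
    coneRingIncl K D (AddMonoidAlgebra.single d c) = AddMonoidAlgebra.single (d : Char r m) c :=
  AddMonoidAlgebra.mapDomain_single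

theorem coneRingIncl_injective : Function.Injective (coneRingIncl K D) :=
  AddMonoidAlgebra.mapDomain_injective Subtype.val_injective

theorem coneRingIncl_coeff (a : coneRing K D) (d : D.dualMonoid) :
    (coneRingIncl K D a).coeff d = a.coeff d := by
  classical
  induction a using AddMonoidAlgebra.induction_linear with
  | zero => simp
  | add f g hf hg => rw [map_add, AddMonoidAlgebra.coeff_add, Finsupp.add_apply, hf, hg]; rfl
  | single v k =>
    rw [coneRingIncl_single, AddMonoidAlgebra.coeff_single, AddMonoidAlgebra.coeff_single,
      Finsupp.single_apply, Finsupp.single_apply]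
    simp only [Subtype.ext_iff]

theorem mem_of_coneRingIncl_coeff_ne_zero {a : coneRing K D} {d : Char r m}
    (h : (coneRingIncl K D a).coeff d ≠ 0) : d ∈ D.dualMonoid := by
  classical
  induction a using AddMonoidAlgebra.induction_linear with
  | zero => simp at h
  | add f g hf hg =>
    rw [map_add, AddMonoidAlgebra.coeff_add, Finsupp.add_apply] at h
    by_cases h0 : (coneRingIncl K D f).coeff d = 0
    · exact hg (by rwa [h0, zero_add] at h)
    · exact hf h0
  | single v k =>
    rw [coneRingIncl_single, AddMonoidAlgebra.coeff_single, Finsupp.single_apply] at h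
    have : (v : Char r m) = d := by
      by_contra hne
      exact h (if_neg hne)
    exact this ▸ v.2

theorem exists_coneRingIncl_eq {F : AddMonoidAlgebra K (Char r m)}
    (h : ∀ d, F.coeff d ≠ 0 → d ∈ D.dualMonoid) : ∃ a, coneRingIncl K D a = F := by
  refine ⟨∑ d ∈ F.coeff.support.attach,
    AddMonoidAlgebra.single ⟨d.1, h d.1 (Finsupp.mem_support_iff.1 d.2)⟩ (F.coeff d.1), ?_⟩
  rw [map_sum]
  simp only [coneRingIncl_single]
  rw [Finset.sum_attach F.coeff.support fun d => AddMonoidAlgebra.single d (F.coeff d)]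
  exact AddMonoidAlgebra.sum_coeff_single F

/-- Reduces restriction to evaluation at the generic point, one degree `u` at a time. -/
theorem restriction_coeff (a : coneRing K D) (u : Fin r → ℤ) :
    (restriction D L a : AddMonoidAlgebra (RatFunc K) (Fin r → ℤ)).coeff u =
      evalUnits L.genericPoint (slice u (coneRingIncl K D a)) := by
  classical
  induction a using AddMonoidAlgebra.induction_linear with
  | zero => simp
  | add f g hf hg =>
    rw [map_add, map_add, map_add, map_add, ← hf, ← hg]
    rfl
  | single d c =>
    rw [coneRingIncl_single, slice_single, restriction, AddMonoidAlgebra.lift_single]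
    change (c • AddMonoidAlgebra.single (d : Char r m).1
      (L.restrictMonomial (d : Char r m).2)).coeff u = _
    rw [AddMonoidAlgebra.coeff_smul, Finsupp.smul_apply, AddMonoidAlgebra.coeff_single,
      Finsupp.single_apply]
    split_ifs
    · rw [L.evalUnits_genericPoint_single]
    · simp

theorem mem_ker_restriction_iff {a : coneRing K D} : a ∈ RingHom.ker (restriction D L) ↔
    ∀ u, evalUnits L.genericPoint (slice u (coneRingIncl K D a)) = 0 := by
  rw [RingHom.mem_ker]
  constructor
  · intro h u
    rw [← restriction_coeff, h]
    rfl
  · intro h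
    apply Subtype.ext
    ext u
    rw [restriction_coeff, h]
    rfl

variable {D}

/-- Multiplication by `1, z_1, …, z_m` never lowers `v_1, …, v_m` and raises their sum by at most
one. Hence only the bound of index `0` needs room, and `P` provides it. -/
theorem extend_add_unitExp_le (v : Fin m → ℤ) (k i : Fin (m + 1)) :
    -PolyhedralData.extend (v + unitExp k) i ≤ -PolyhedralData.extend v i + if i = 0 then 1 else 0 := by
  classical
  have hnn : ∀ j, 0 ≤ unitExp k j := by
    intro j
    induction k using Fin.cases with
    | zero => simp [unitExp]
    | succ k =>
      simp only [unitExp, Fin.cons_succ, Pi.single_apply]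
      split_ifs <;> norm_num
  induction i using Fin.cases with
  | zero =>
    have : ∑ j, unitExp k j ≤ 1 := by
      induction k using Fin.cases with
      | zero => simp [unitExp]
      | succ k => simp [unitExp]
    simp only [PolyhedralData.extend, Fin.cons_zero, Pi.add_apply, Finset.sum_add_distrib, if_true]
    linarith
  | succ j =>
    have := hnn j
    simp only [PolyhedralData.extend, Fin.cons_succ, Pi.add_apply, Fin.succ_ne_zero, if_false]
    linarith

theorem add_unitExp_mem_dualMonoid {c : Char r m} (hc : c ∈ D.latticeP) (k : Fin (m + 1)) :
    (c.1, c.2 + unitExp k) ∈ D.dualMonoid := by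
  obtain ⟨h1, h2, h3⟩ := D.mem_latticeP_iff.1 hc
  refine D.mem_dualMonoid_iff.2 ⟨h1, fun i x hx => ?_⟩
  have hle := extend_add_unitExp_le c.2 k i
  refine le_trans (Int.cast_le.2 hle) ?_
  induction i using Fin.cases with
  | zero =>
    have := h3 x hx
    simp only [PolyhedralData.extend, Fin.cons_zero, neg_neg, if_true]
    exact this
  | succ j =>
    have := h2 j x hx
    simp only [PolyhedralData.extend, Fin.cons_succ, Fin.succ_ne_zero, if_false, add_zero]
    exact this

/-- The elements `(g z^v) χ^u` lie in `A(C)`. -/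
theorem exists_coneRingIncl_eq_twist {g : Laurent K (Fin m)} (hg : IsDehomogenizedLinear g)
    {c : Char r m} (hc : c ∈ D.latticeP) :
    ∃ a, coneRingIncl K D a = twist c.1 (g * AddMonoidAlgebra.single c.2 1) := by
  obtain ⟨l, rfl⟩ := isDehomogenizedLinear_iff.1 hg
  refine exists_coneRingIncl_eq D fun d hd => ?_
  have hd1 := fst_eq_of_twist_coeff_ne_zero hd
  obtain ⟨u, v⟩ := d
  obtain rfl : u = c.1 := hd1
  rw [twist_coeff, AddMonoidAlgebra.coeff_mul_single_apply, mul_one] at hd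
  obtain ⟨k, hk, -⟩ := exists_of_affineForm_coeff_ne_zero hd
  have hv : v = c.2 + unitExp k := by rw [← hk]; abel
  rw [hv]
  exact add_unitExp_mem_dualMonoid hc k

variable {L}

/-- The claim is linear in `l`, so by `relations_le_span` it suffices to take `l` from `G`; a
lattice point of `P` is then reached from a generator by a monomial of `A(C)`. -/
theorem exists_mem_of_mem_relations [IsAlgClosed K] {G : Set (Laurent K (Fin m))}
    (hG : IsTropicalBasis L.torusPart G) (hlin : ∀ g ∈ G, IsDehomogenizedLinear g)
    {Q : Set (Char r m)} (hQ : D.IsLatticeGenerators Q) {N : Ideal (coneRing K D)}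
    (hN : ∀ a, coneRingIncl K D a ∈ linearGenerators G Q → a ∈ N) {p : Char r m}
    (hp : p ∈ D.latticeP) {l : Fin (m + 1) → K} (hl : l ∈ L.relations) :
    ∃ b ∈ N, coneRingIncl K D b =
      twist p.1 (affineForm l * AddMonoidAlgebra.single p.2 1) := by
  obtain ⟨q, hq, c, hc, rfl⟩ := hQ.2 _ hp
  have hl' := L.relations_le_span hG hlin hl
  clear hl
  induction hl' using Submodule.span_induction with
  | mem l hl =>
    obtain ⟨b, hb⟩ := exists_coneRingIncl_eq_twist (hlin _ hl) (hQ.1 hq)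
    refine ⟨AddMonoidAlgebra.single ⟨c, hc⟩ 1 * b, N.mul_mem_left _
      (hN _ ⟨_, hl, q, hq, hb⟩), ?_⟩
    rw [map_mul, coneRingIncl_single, hb, single_mul_twist, mul_left_comm,
      AddMonoidAlgebra.single_mul_single, mul_one, Prod.fst_add, Prod.snd_add, add_comm q.1,
      add_comm q.2]
  | zero => exact ⟨0, N.zero_mem, by rw [map_zero, map_zero, zero_mul, twist_zero]⟩
  | add x y _ _ hx hy =>
    obtain ⟨b, hb, hb'⟩ := hx
    obtain ⟨c, hc, hc'⟩ := hy
    exact ⟨b + c, N.add_mem hb hc, by rw [map_add, map_add, add_mul, twist_add, hb', hc']⟩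
  | smul k x _ hx =>
    obtain ⟨b, hb, hb'⟩ := hx
    exact ⟨k • b, Submodule.smul_of_tower_mem N k hb, by
      rw [map_smul, map_smul, smul_mul_assoc, twist_smul, hb']⟩

/-- Provides the tightest integral bounds on the exponents of `f`. As each is attained in the
support, it stays below `Δ_i(u)` when `f χ^u ∈ A(C)`, even if `Δ_i(u)` is infinite. -/
theorem exists_extend_le {f : Laurent K (Fin m)} (hf : f ≠ 0) :
    ∃ V : Fin (m + 1) → (Fin m → ℤ), ∀ i, f.coeff (V i) ≠ 0 ∧
      ∀ v, f.coeff v ≠ 0 → -PolyhedralData.extend v i ≤ -PolyhedralData.extend (V i) i := by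
  have hne : f.coeff.support.Nonempty := by
    rw [Finsupp.support_nonempty_iff]
    exact fun h => hf (AddMonoidAlgebra.coeff_eq_zero.1 h)
  have h : ∀ i, ∃ V, f.coeff V ≠ 0 ∧
      ∀ v, f.coeff v ≠ 0 → -PolyhedralData.extend v i ≤ -PolyhedralData.extend V i := by
    intro i
    obtain ⟨V, h1, h2⟩ :=
      f.coeff.support.exists_max_image (fun v => -PolyhedralData.extend v i) hne
    exact ⟨V, Finsupp.mem_support_iff.1 h1, fun v hv => h2 v (Finsupp.mem_support_iff.2 hv)⟩
  exact Classical.skolem.1 h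

/-- The bounds from the support of `f` turn the multipliers of the linear relations into lattice
points of `P` of degree `u`, so each summand already lies in `A(C)`. -/
theorem mem_of_evalUnits_genericPoint [IsAlgClosed K] {G : Set (Laurent K (Fin m))}
    (hG : IsTropicalBasis L.torusPart G) (hlin : ∀ g ∈ G, IsDehomogenizedLinear g)
    {Q : Set (Char r m)} (hQ : D.IsLatticeGenerators Q) {N : Ideal (coneRing K D)}
    (hN : ∀ a, coneRingIncl K D a ∈ linearGenerators G Q → a ∈ N) {a : coneRing K D}
    {u : Fin r → ℤ} {f : Laurent K (Fin m)} (ha : coneRingIncl K D a = twist u f)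
    (hf : evalUnits L.genericPoint f = 0) : a ∈ N := by
  classical
  by_cases hf0 : f = 0
  · have : a = 0 := coneRingIncl_injective D (by rw [ha, hf0, twist_zero, map_zero])
    rw [this]
    exact N.zero_mem
  have hmem : ∀ v, f.coeff v ≠ 0 → (u, v) ∈ D.dualMonoid := by
    intro v hv
    refine mem_of_coneRingIncl_coeff_ne_zero D (a := a) ?_
    rwa [ha, twist_coeff]
  obtain ⟨V, hV⟩ := exists_extend_le hf0
  have hbound : ∀ i, ∀ x ∈ D.Δ i,
      ((-PolyhedralData.extend (V i) i : ℤ) : ℚ) ≤ pair u x := fun i x hx =>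
    (D.mem_dualMonoid_iff.1 (hmem _ (hV i).1)).2 i x hx
  have hu : D.InDual u := (D.mem_dualMonoid_iff.1 (hmem _ (hV 0).1)).1
  have hspan := L.mem_span_of_evalUnits_genericPoint
    (a := fun i => -PolyhedralData.extend (V i) i)
    (fun v hv i => (hV i).2 v hv) hf
  obtain ⟨b, hb, hab⟩ : ∃ b ∈ N, coneRingIncl K D b = twist u f := by
    clear ha hf hf0 hmem hV
    induction hspan using Submodule.span_induction with
    | mem h hh =>
      obtain ⟨l, hl, v, hv1, hv2, rfl⟩ := hh
      have hP : (u, v) ∈ D.latticeP := D.mem_latticeP_iff.2 ⟨hu, fun j x hx =>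
        (Int.cast_le.2 (hv1 j)).trans (hbound _ x hx), fun x hx =>
        (Int.cast_le.2 hv2).trans (hbound _ x hx)⟩
      exact exists_mem_of_mem_relations hG hlin hQ hN hP hl
    | zero => exact ⟨0, N.zero_mem, by rw [map_zero, twist_zero]⟩
    | add x y _ _ hx hy =>
      obtain ⟨b, hb, hb'⟩ := hx
      obtain ⟨c, hc, hc'⟩ := hy
      exact ⟨b + c, N.add_mem hb hc, by rw [map_add, twist_add, hb', hc']⟩
    | smul k x _ hx =>
      obtain ⟨b, hb, hb'⟩ := hx
      exact ⟨k • b, Submodule.smul_of_tower_mem N k hb, by rw [map_smul, twist_smul, hb']⟩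
  rw [coneRingIncl_injective D (ha.trans hab.symm)]
  exact hb

theorem span_linearGenerators [IsAlgClosed K] {G : Set (Laurent K (Fin m))}
    (hG : IsTropicalBasis L.torusPart G) (hlin : ∀ g ∈ G, IsDehomogenizedLinear g)
    {Q : Set (Char r m)} (hQ : D.IsLatticeGenerators Q) :
    Ideal.span {a : coneRing K D | coneRingIncl K D a ∈ linearGenerators G Q} =
      tildeIdeal D L := by
  have : Infinite K := IsAlgClosed.instInfinite
  refine le_antisymm (Ideal.span_le.2 ?_) (Ideal.span_le.2 ?_)
  · rintro a ⟨g, hg, c, hc, hac⟩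
    exact Ideal.subset_span ⟨c.1, _, Ideal.mul_mem_right _ _ (hG.1 hg), hac⟩
  · rintro a ⟨u, f, hf, ha⟩
    exact mem_of_evalUnits_genericPoint hG hlin hQ (fun _ h => Ideal.subset_span h) ha
      (L.evalUnits_genericPoint_of_mem_torusIdeal hf)

/-- The kernel is graded by `M`: each homogeneous piece of an element is again in `A(C)` and
vanishes at the generic point, so it is covered by the linear generators. -/
theorem tildeIdeal_eq_ker [IsAlgClosed K] {G : Set (Laurent K (Fin m))}
    (hG : IsTropicalBasis L.torusPart G) (hlin : ∀ g ∈ G, IsDehomogenizedLinear g)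
    {Q : Set (Char r m)} (hQ : D.IsLatticeGenerators Q) :
    tildeIdeal D L = RingHom.ker (restriction D L) := by
  classical
  have : Infinite K := IsAlgClosed.instInfinite
  refine le_antisymm (Ideal.span_le.2 ?_) fun a ha => ?_
  · rintro a ⟨u, f, hf, ha⟩
    refine (mem_ker_restriction_iff D L).2 fun u' => ?_
    rw [ha]
    by_cases h : u = u'
    · rw [h, slice_twist]
      exact L.evalUnits_genericPoint_of_mem_torusIdeal hf
    · rw [slice_twist_of_ne h, map_zero]
  · rw [mem_ker_restriction_iff] at ha
    rw [← span_linearGenerators hG hlin hQ]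
    let s := (coneRingIncl K D a).coeff.support.image Prod.fst
    have hs := sum_twist_slice (coneRingIncl K D a) s fun d hd =>
      Finset.mem_image_of_mem _ (Finsupp.mem_support_iff.2 hd)
    have hex : ∀ u, ∃ b, coneRingIncl K D b = twist u (slice u (coneRingIncl K D a)) := by
      intro u
      refine exists_coneRingIncl_eq D fun d hd => ?_
      have hd1 := fst_eq_of_twist_coeff_ne_zero hd
      obtain ⟨u', v⟩ := d
      obtain rfl : u' = u := hd1
      rw [twist_coeff, slice_coeff] at hd
      exact mem_of_coneRingIncl_coeff_ne_zero D hd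
    choose b hb using hex
    have hab : a = ∑ u ∈ s, b u := coneRingIncl_injective D (by
      rw [map_sum, hs]
      simp only [hb])
    rw [hab]
    exact Ideal.sum_mem _ fun u _ => mem_of_evalUnits_genericPoint hG hlin hQ
      (fun _ h => Ideal.subset_span h) (hb u) (ha u)

end ConeRing

/-! ### The toric ideal, term-by-term lifts, and weights that descend to the lattice. -/

section Lifts

variable {K : Type*} [Field K] {r m : ℕ} {D : PolyhedralData r m} {H : Finset D.dualMonoid}

theorem latticeDegree_add (α β : H →₀ ℕ) :
    latticeDegree H (α + β) = latticeDegree H α + latticeDegree H β :=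
  Finsupp.sum_add_index' (fun _ => zero_smul _ _) fun _ _ _ => add_smul _ _ _

theorem latticeDegree_single (h : H) (n : ℕ) :
    latticeDegree H (Finsupp.single h n) = n • (h : D.dualMonoid) :=
  Finsupp.sum_single_index (zero_smul _ _)

theorem toricMap_monomial (α : H →₀ ℕ) (c : K) :
    toricMap K H (MvPolynomial.monomial α c) = AddMonoidAlgebra.single (latticeDegree H α) c := by
  rw [toricMap, MvPolynomial.aeval_monomial]
  have : (α.prod fun h n => (AddMonoidAlgebra.single (h : D.dualMonoid) (1 : K)) ^ n) =
      AddMonoidAlgebra.single (latticeDegree H α) 1 := by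
    simp only [AddMonoidAlgebra.single_pow, one_pow]
    rw [Finsupp.prod, AddMonoidAlgebra.prod_single, Finset.prod_const_one]
    rfl
  rw [this, AddMonoidAlgebra.coe_algebraMap, Function.comp_apply,
    AddMonoidAlgebra.single_mul_single, zero_add, mul_one]
  rfl

theorem latticeDegree_surjective (hH : AddSubmonoid.closure (H : Set D.dualMonoid) = ⊤) :
    Function.Surjective (latticeDegree H) := by
  intro d
  have hd : d ∈ AddSubmonoid.closure (H : Set D.dualMonoid) := hH ▸ AddSubmonoid.mem_top d
  induction hd using AddSubmonoid.closure_induction with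
  | mem d hd => exact ⟨Finsupp.single ⟨d, hd⟩ 1, by rw [latticeDegree_single, one_smul]⟩
  | zero => exact ⟨0, Finsupp.sum_zero_index⟩
  | add d e _ _ hd he =>
    obtain ⟨α, rfl⟩ := hd
    obtain ⟨β, rfl⟩ := he
    exact ⟨α + β, latticeDegree_add α β⟩

/-- The lift of an element of `A(C)` obtained from a choice of a monomial in each degree. -/
def liftAlong (s : D.dualMonoid → (H →₀ ℕ)) (a : coneRing K D) : MvPolynomial H K :=
  a.coeff.sum fun d c => MvPolynomial.monomial (s d) c

theorem liftAlong_zero (s : D.dualMonoid → (H →₀ ℕ)) : liftAlong s (0 : coneRing K D) = 0 :=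
  Finsupp.sum_zero_index

theorem liftAlong_add (s : D.dualMonoid → (H →₀ ℕ)) (a b : coneRing K D) :
    liftAlong s (a + b) = liftAlong s a + liftAlong s b := by
  classical
  rw [liftAlong, AddMonoidAlgebra.coeff_add, Finsupp.sum_add_index']
  · rfl
  · simp
  · simp

theorem liftAlong_single (s : D.dualMonoid → (H →₀ ℕ)) (d : D.dualMonoid) (c : K) :
    liftAlong s (AddMonoidAlgebra.single d c) = MvPolynomial.monomial (s d) c := by
  rw [liftAlong, AddMonoidAlgebra.coeff_single, Finsupp.sum_single_index (by simp)]

theorem toricMap_liftAlong {s : D.dualMonoid → (H →₀ ℕ)} (hs : ∀ d, latticeDegree H (s d) = d)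
    (a : coneRing K D) : toricMap K H (liftAlong s a) = a := by
  induction a using AddMonoidAlgebra.induction_linear with
  | zero => rw [liftAlong_zero, map_zero]
  | add a b ha hb => rw [liftAlong_add, map_add, ha, hb]
  | single d c => rw [liftAlong_single, toricMap_monomial, hs]

theorem toricMap_surjective (hH : AddSubmonoid.closure (H : Set D.dualMonoid) = ⊤) :
    Function.Surjective (toricMap K H) := by
  choose s hs using latticeDegree_surjective hH
  exact fun a => ⟨_, toricMap_liftAlong hs a⟩

theorem exists_isTermwiseLift (hH : AddSubmonoid.closure (H : Set D.dualMonoid) = ⊤)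
    (a : coneRing K D) : ∃ F : MvPolynomial H K, IsTermwiseLift H F (coneRingIncl K D a) := by
  classical
  choose s hs using latticeDegree_surjective hH
  refine ⟨liftAlong s a, by rw [toricMap_liftAlong hs], ?_⟩
  have hsupp : ∀ α ∈ (liftAlong s a).support, ∃ d, α = s d := by
    intro α hα
    rw [MvPolynomial.mem_support_iff, liftAlong, Finsupp.sum, MvPolynomial.coeff_sum] at hα
    obtain ⟨d, -, hd⟩ := Finset.exists_ne_zero_of_sum_ne_zero hα
    rw [MvPolynomial.coeff_monomial] at hd
    refine ⟨d, ?_⟩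
    by_contra hne
    exact hd (if_neg (Ne.symm hne))
  intro α hα β hβ h
  obtain ⟨d, rfl⟩ := hsupp α hα
  obtain ⟨e, rfl⟩ := hsupp β hβ
  rw [hs, hs] at h
  rw [h]

/-- The toric ideal is generated by binomials. -/
theorem exists_binomials (hH : AddSubmonoid.closure (H : Set D.dualMonoid) = ⊤) :
    ∃ B : Set (MvPolynomial H K), (∀ f ∈ B, IsBinomial f) ∧ Ideal.span B = toricIdeal K H := by
  choose s hs using latticeDegree_surjective hH
  refine ⟨{f | ∃ α β, latticeDegree H α = latticeDegree H β ∧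
    f = MvPolynomial.monomial α 1 - MvPolynomial.monomial β 1}, ?_, le_antisymm ?_ ?_⟩
  · rintro f ⟨α, β, -, rfl⟩
    exact ⟨α, β, 1, -1, by rw [map_neg, sub_eq_add_neg]⟩
  · rw [Ideal.span_le]
    rintro f ⟨α, β, h, rfl⟩
    change toricMap K H _ = 0
    rw [map_sub, toricMap_monomial, toricMap_monomial, h, sub_self]
  · intro F hF
    -- Modulo binomials every monomial equals the chosen one of its degree; elements of the toric
    -- ideal have zero normal form.
    have key : ∀ F : MvPolynomial H K, F - liftAlong s (toricMap K H F) ∈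
        Ideal.span {f : MvPolynomial H K | ∃ α β, latticeDegree H α = latticeDegree H β ∧
          f = MvPolynomial.monomial α 1 - MvPolynomial.monomial β 1} := by
      intro F
      induction F using MvPolynomial.induction_on' with
      | monomial α c =>
        rw [toricMap_monomial, liftAlong_single]
        have : MvPolynomial.monomial α c - MvPolynomial.monomial (s (latticeDegree H α)) c =
            MvPolynomial.C c * (MvPolynomial.monomial α 1 -
              MvPolynomial.monomial (s (latticeDegree H α)) 1) := by
          rw [mul_sub, MvPolynomial.C_mul_monomial, MvPolynomial.C_mul_monomial, mul_one]
        rw [this]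
        exact Ideal.mul_mem_left _ _ (Ideal.subset_span ⟨_, _, (hs _).symm, rfl⟩)
      | add f g hf hg =>
        rw [map_add, liftAlong_add, add_sub_add_comm]
        exact Ideal.add_mem _ hf hg
    have h1 := key F
    rw [show toricMap K H F = 0 from hF, liftAlong_zero, sub_zero] at h1
    exact h1

theorem toricMap_eq_sum (F : MvPolynomial H K) : toricMap K H F =
    ∑ α ∈ F.support, AddMonoidAlgebra.single (latticeDegree H α) (F.coeff α) := by
  conv_lhs => rw [F.as_sum]
  rw [map_sum]
  simp only [toricMap_monomial]

theorem IsTermwiseLift.coeff_latticeDegree {F : MvPolynomial H K}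
    {a : AddMonoidAlgebra K (Char r m)} (h : IsTermwiseLift H F a) {α : H →₀ ℕ}
    (hα : F.coeff α ≠ 0) : a.coeff (latticeDegree H α : D.dualMonoid) = F.coeff α := by
  classical
  rw [← h.1, coneRingIncl_coeff, toricMap_eq_sum, AddMonoidAlgebra.coeff_sum,
    Finsupp.finsetSum_apply, Finset.sum_eq_single α]
  · simp
  · intro β hβ hne
    rw [AddMonoidAlgebra.coeff_single, Finsupp.single_apply, if_neg]
    exact fun he => hne (h.2 hβ (MvPolynomial.mem_support_iff.2 hα) he)
  · exact fun hα' => absurd (MvPolynomial.mem_support_iff.2 hα) hα'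

theorem IsTermwiseLift.exists_latticeDegree {F : MvPolynomial H K}
    {a : AddMonoidAlgebra K (Char r m)} (h : IsTermwiseLift H F a) {d : Char r m}
    (hd : a.coeff d ≠ 0) : ∃ α, F.coeff α ≠ 0 ∧ (latticeDegree H α : Char r m) = d := by
  classical
  rw [← h.1] at hd
  have hmem := mem_of_coneRingIncl_coeff_ne_zero D hd
  have hd' : (coneRingIncl K D (toricMap K H F)).coeff ((⟨d, hmem⟩ : D.dualMonoid) : Char r m) ≠ 0 :=
    hd
  rw [coneRingIncl_coeff, toricMap_eq_sum, AddMonoidAlgebra.coeff_sum,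
    Finsupp.finsetSum_apply] at hd'
  obtain ⟨α, hα, hα'⟩ := Finset.exists_ne_zero_of_sum_ne_zero hd'
  rw [AddMonoidAlgebra.coeff_single, Finsupp.single_apply] at hα'
  refine ⟨α, MvPolynomial.mem_support_iff.1 hα, ?_⟩
  by_contra hne
  exact hα' (if_neg fun he => hne (congrArg Subtype.val he))

/-- If each generator of the toric ideal is homogeneous for the weight `W`, then `W` only depends
on the degree in the lattice. -/
theorem weight_eq_of_latticeDegree_eq {B : Set (MvPolynomial H K)}
    (hB : Ideal.span B = toricIdeal K H) (W : (H →₀ ℕ) →+ ℝ)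
    (hW : ∀ f ∈ B, ∀ α β, f.coeff α ≠ 0 → f.coeff β ≠ 0 → W α = W β) {α β : H →₀ ℕ}
    (h : latticeDegree H α = latticeDegree H β) : W α = W β := by
  classical
  -- The toric map refined by recording the weight. It kills `B` by homogeneity, hence the whole
  -- toric ideal, including `x^α - x^β`; so these two monomials have the same weight.
  let Φ : MvPolynomial H K →ₐ[K] AddMonoidAlgebra K (D.dualMonoid × ℝ) :=
    MvPolynomial.aeval fun h => AddMonoidAlgebra.single ((h : D.dualMonoid),
      W (Finsupp.single h 1)) 1
  have hΦ : ∀ (α : H →₀ ℕ) (c : K), Φ (MvPolynomial.monomial α c) =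
      AddMonoidAlgebra.single (latticeDegree H α, W α) c := by
    intro α c
    rw [show Φ = MvPolynomial.aeval _ from rfl, MvPolynomial.aeval_monomial]
    have : (α.prod fun h n => (AddMonoidAlgebra.single ((h : D.dualMonoid),
        W (Finsupp.single h 1)) (1 : K)) ^ n) =
        AddMonoidAlgebra.single (latticeDegree H α, W α) 1 := by
      simp only [AddMonoidAlgebra.single_pow, one_pow]
      rw [Finsupp.prod, AddMonoidAlgebra.prod_single, Finset.prod_const_one]
      congr 1
      refine Prod.ext ?_ ?_
      · rw [Prod.fst_sum]; rfl
      · rw [Prod.snd_sum]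
        conv_rhs => rw [← Finsupp.sum_single α]
        rw [Finsupp.sum, map_sum]
        refine Finset.sum_congr rfl fun h _ => ?_
        change α h • W (Finsupp.single h 1) = _
        rw [← map_nsmul]
        congr 1
        simp
    rw [this, AddMonoidAlgebra.coe_algebraMap, Function.comp_apply,
      AddMonoidAlgebra.single_mul_single, zero_add, mul_one]
    rfl
  have hker : Ideal.span B ≤ RingHom.ker Φ := by
    refine Ideal.span_le.2 fun f hf => ?_
    change Φ f = 0
    by_cases h0 : f = 0
    · rw [h0, map_zero]
    obtain ⟨γ, hγ⟩ := MvPolynomial.ne_zero_iff.1 h0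
    have h1 : toricMap K H f = 0 := by
      have : f ∈ toricIdeal K H := hB ▸ Ideal.subset_span hf
      exact this
    have h2 : Φ f = AddMonoidAlgebra.mapDomain (fun d => (d, W γ)) (toricMap K H f) := by
      rw [toricMap_eq_sum]
      conv_lhs => rw [f.as_sum]
      have hsum : ∀ (s : Finset (H →₀ ℕ)) (v : (H →₀ ℕ) → coneRing K D),
          AddMonoidAlgebra.mapDomain (fun d => (d, W γ)) (∑ α ∈ s, v α) =
            ∑ α ∈ s, AddMonoidAlgebra.mapDomain (fun d => (d, W γ)) (v α) := by
        intro s v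
        induction s using Finset.induction_on with
        | empty => simp
        | insert a s ha ih =>
          rw [Finset.sum_insert ha, Finset.sum_insert ha, AddMonoidAlgebra.mapDomain_add, ih]
      rw [map_sum, hsum]
      refine Finset.sum_congr rfl fun α hα => ?_
      rw [hΦ, AddMonoidAlgebra.mapDomain_single,
        hW f hf α γ (MvPolynomial.mem_support_iff.1 hα) hγ]
    rw [h2, h1, AddMonoidAlgebra.mapDomain_zero]
  have hmem : MvPolynomial.monomial α (1 : K) - MvPolynomial.monomial β 1 ∈ Ideal.span B := by
    rw [hB]
    change toricMap K H _ = 0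
    rw [map_sub, toricMap_monomial, toricMap_monomial, h, sub_self]
  have h3 : Φ (MvPolynomial.monomial α (1 : K) - MvPolynomial.monomial β 1) = 0 := hker hmem
  rw [map_sub, hΦ, hΦ, sub_eq_zero, AddMonoidAlgebra.single_left_inj one_ne_zero] at h3
  exact congrArg Prod.snd h3

variable (H) in
/-- The map `ℤ^H → M × ℤ^m` given by the elements of `H`. -/
def degreeHom : (H → ℤ) →ₗ[ℤ] Char r m :=
  Fintype.linearCombination ℤ fun h : H => ((h : D.dualMonoid) : Char r m)

theorem degreeHom_apply (n : H → ℤ) :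
    degreeHom H n = ∑ h, n h • ((h : D.dualMonoid) : Char r m) := rfl

theorem degreeHom_natCast (α : H →₀ ℕ) :
    degreeHom H (fun h => (α h : ℤ)) = (latticeDegree H α : D.dualMonoid) := by
  rw [degreeHom_apply, latticeDegree, Finsupp.sum_fintype _ _ (by simp)]
  rw [AddSubmonoid.coe_finsetSum]
  simp

/-- A weight on `ℤ^H` compatible with degrees extends to the lattice. -/
theorem exists_extension (w : H → ℝ)
    (hw : ∀ α β : H →₀ ℕ, latticeDegree H α = latticeDegree H β →
      weightHom w (fun h => (α h : ℤ)) = weightHom w (fun h => (β h : ℤ))) :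
    ∃ ω : Char r m →+ ℝ, ∀ n, ω (degreeHom H n) = weightHom w n := by
  classical
  have hker : LinearMap.ker (degreeHom H) ≤ LinearMap.ker (weightHom w).toIntLinearMap := by
    intro n hn
    have hn' : degreeHom H n = 0 := hn
    -- An integral relation among the degrees is split into positive and negative parts, which are
    -- monomials of equal degree.
    let α : H →₀ ℕ := Finsupp.equivFunOnFinite.symm fun h => (n h).toNat
    let β : H →₀ ℕ := Finsupp.equivFunOnFinite.symm fun h => (-n h).toNat
    have hαβ : n = (fun h => (α h : ℤ)) - fun h => (β h : ℤ) := by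
      ext h
      simp only [Pi.sub_apply, α, β, Finsupp.coe_equivFunOnFinite_symm]
      omega
    have h1 : latticeDegree H α = latticeDegree H β := by
      apply Subtype.ext
      rw [← degreeHom_natCast, ← degreeHom_natCast, ← sub_eq_zero, ← map_sub, ← hαβ, hn']
    change weightHom w n = 0
    rw [hαβ, map_sub, hw α β h1, sub_self]
  -- Modulo its kernel the degree map is injective. Since `ℝ` is divisible, the weight extends from
  -- the image to all of `M × ℤ^m`, whether or not `H` generates this lattice.
  obtain ⟨ω, hω⟩ := (Module.Baer.of_divisible ℝ).extension_property
    ((LinearMap.ker (degreeHom H)).liftQ (degreeHom H) le_rfl)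
    (LinearMap.ker_eq_bot.1 (Submodule.ker_liftQ_eq_bot _ _ _ le_rfl))
    ((LinearMap.ker (degreeHom H)).liftQ (weightHom w).toIntLinearMap hker)
  refine ⟨ω.toAddMonoidHom, fun n => ?_⟩
  exact LinearMap.congr_fun hω (Submodule.Quotient.mk n)

end Lifts

/-! ### Points of the variety from the torus of M and the line. -/

section Points

variable {K : Type*} [Field K] {r m : ℕ} {D : PolyhedralData r m} {L : TorusLine K m}
  {H : Finset D.dualMonoid}

/-- The partial evaluation `K[M × ℤ^m] → K[M]` at a point of the torus `(Kˣ)^m`. -/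
def partialEval (z : Fin m → Kˣ) : AddMonoidAlgebra K (Char r m) →ₐ[K] Laurent K (Fin r) :=
  AddMonoidAlgebra.lift K _ (Char r m)
    { toFun := fun d => AddMonoidAlgebra.single d.toAdd.1 ((∏ i, z i ^ d.toAdd.2 i : Kˣ) : K)
      map_one' := by simp [AddMonoidAlgebra.one_def]
      map_mul' := fun a b => by
        simp [AddMonoidAlgebra.single_mul_single, zpow_add, Finset.prod_mul_distrib] }

theorem partialEval_single (z : Fin m → Kˣ) (d : Char r m) (c : K) :
    partialEval z (AddMonoidAlgebra.single d c) =
      AddMonoidAlgebra.single d.1 (c * ((∏ i, z i ^ d.2 i : Kˣ) : K)) := by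
  rw [partialEval, AddMonoidAlgebra.lift_single, MonoidHom.coe_mk, OneHom.coe_mk,
    AddMonoidAlgebra.smul_single, smul_eq_mul]
  rfl

theorem partialEval_coeff (z : Fin m → Kˣ) (F : AddMonoidAlgebra K (Char r m)) (u : Fin r → ℤ) :
    (partialEval z F).coeff u = evalTorus z (slice u F) := by
  classical
  induction F using AddMonoidAlgebra.induction_linear with
  | zero => simp
  | add f g hf hg => rw [map_add, map_add, map_add, AddMonoidAlgebra.coeff_add, Finsupp.add_apply,
      hf, hg]
  | single d c =>
    rw [partialEval_single, slice_single, AddMonoidAlgebra.coeff_single, Finsupp.single_apply]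
    split_ifs
    · rw [evalTorus_single]
    · rw [map_zero]

/-- The point of `(Kˣ)^H` with coordinates `t^u z^v`, for `(u, v) ∈ H`. -/
def monomialPoint (H : Finset D.dualMonoid) (t : Fin r → Kˣ) (z : Fin m → Kˣ) : H → Kˣ := fun h =>
  (∏ k, t k ^ ((h : D.dualMonoid) : Char r m).1 k) *
    ∏ i, z i ^ ((h : D.dualMonoid) : Char r m).2 i

theorem evalTorus_monomialPoint (t : Fin r → Kˣ) (z : Fin m → Kˣ) (f : Laurent K H) :
    evalTorus (monomialPoint H t z) f =
      evalTorus t (partialEval z (AddMonoidAlgebra.mapDomain (degreeHom H) f)) := by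
  induction f using AddMonoidAlgebra.induction_linear with
  | zero => simp
  | add f g hf hg => rw [map_add, AddMonoidAlgebra.mapDomain_add, map_add, map_add, hf, hg]
  | single n c =>
    rw [AddMonoidAlgebra.mapDomain_single, partialEval_single, evalTorus_single, evalTorus_single,
      mul_assoc, ← Units.val_mul]
    congr 2
    have hz : ∀ {s : ℕ} (x : Fin s → Kˣ) (e : H → Fin s → ℤ),
        ∏ h, (∏ k, x k ^ e h k) ^ n h = ∏ k, x k ^ (∑ h, n h * e h k) := by
      intro s x e
      simp only [← Finset.prod_zpow, ← zpow_mul]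
      rw [Finset.prod_comm]
      refine Finset.prod_congr rfl fun k _ => ?_
      induction (Finset.univ : Finset H) using Finset.induction_on with
      | empty => simp
      | insert j s hj ih =>
        rw [Finset.prod_insert hj, Finset.sum_insert hj, zpow_add, ih, mul_comm (n j)]
    simp only [monomialPoint, mul_zpow, Finset.prod_mul_distrib]
    rw [hz, hz, mul_comm, degreeHom_apply]
    simp [Prod.fst_sum, Prod.snd_sum, Finset.sum_apply]

theorem mapDomain_degreeHom_toLaurent (F : MvPolynomial H K) :
    AddMonoidAlgebra.mapDomain (degreeHom H) (toLaurent F) =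
      coneRingIncl K D (toricMap K H F) := by
  induction F using MvPolynomial.induction_on' with
  | monomial α c =>
    rw [toLaurent_monomial, AddMonoidAlgebra.mapDomain_single, toricMap_monomial,
      coneRingIncl_single, degreeHom_natCast]
  | add f g hf hg => rw [map_add, AddMonoidAlgebra.mapDomain_add, map_add, map_add, hf, hg]

theorem evalTorus_toLaurent_eq_zero {x : H → Kˣ} (hx : x ∈ varietyTorusPart L H)
    {F : MvPolynomial H K} (hF : F ∈ idealJ L H) : evalTorus x (toLaurent F) = 0 := by
  rw [evalTorus_toLaurent]
  exact hx F hF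

/-- The torus of `M` times `L°` maps to `X(L)°`. -/
theorem monomialPoint_mem (hker : RingHom.ker (restriction D L) = tildeIdeal D L)
    (t : Fin r → Kˣ) {z : Fin m → Kˣ} (hz : z ∈ L.torusPart) :
    monomialPoint H t z ∈ varietyTorusPart L H := by
  classical
  intro F hF
  have h1 : toricMap K H F ∈ tildeIdeal D L := by
    rw [← hker]
    exact hF
  rw [← evalTorus_toLaurent, evalTorus_monomialPoint, mapDomain_degreeHom_toLaurent]
  -- At a point `z` of `L°` every generator `f χ^u` already dies before the torus variables are
  -- evaluated.
  have h2 : tildeIdeal D L ≤ RingHom.ker ((partialEval z).comp (coneRingIncl K D)) := by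
    refine Ideal.span_le.2 ?_
    rintro a ⟨u, f, hf, ha⟩
    change partialEval z (coneRingIncl K D a) = 0
    rw [ha]
    ext u'
    rw [partialEval_coeff]
    by_cases h : u = u'
    · rw [h, slice_twist, mem_torusIdeal.1 hf z hz]
      rfl
    · rw [slice_twist_of_ne h, map_zero]
      rfl
  have h3 : partialEval z (coneRingIncl K D (toricMap K H F)) = 0 := h2 h1
  rw [h3, map_zero]

/-- For fixed `z ∈ L°` the pushforward is a Laurent polynomial in `t` vanishing on the whole torus
of `M`, so all its coefficients, the values of the slices at `z`, are zero. Only the points `t^u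
z^v` of `X(L)°` are used. -/
theorem slice_mem_torusIdeal [IsAlgClosed K]
    (hker : RingHom.ker (restriction D L) = tildeIdeal D L) {h : Laurent K H}
    (hh : h ∈ torusIdeal (varietyTorusPart L H)) (u : Fin r → ℤ) :
    slice u (AddMonoidAlgebra.mapDomain (degreeHom H) h) ∈ torusIdeal L.torusPart := by
  refine mem_torusIdeal.2 fun z hz => ?_
  rw [← partialEval_coeff]
  have : partialEval z (AddMonoidAlgebra.mapDomain (degreeHom H) h) = 0 := by
    refine eq_zero_of_forall_evalTorus fun t => ?_
    rw [← evalTorus_monomialPoint]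
    exact mem_torusIdeal.1 hh _ (monomialPoint_mem hker t hz)
  rw [this]
  rfl

/-- With the pulled-back weight, terms identified by `φ` have equal weight, so cancellation never
mixes components. -/
theorem weightComponent_mapDomain {A B : Type*} (φ : A → B) (ω : B → ℝ) (c : ℝ)
    (f : AddMonoidAlgebra K A) :
    weightComponent ω c (AddMonoidAlgebra.mapDomain φ f) =
      AddMonoidAlgebra.mapDomain φ (weightComponent (fun a => ω (φ a)) c f) := by
  classical
  induction f using AddMonoidAlgebra.induction_linear with
  | zero => simp
  | add f g hf hg => simp only [AddMonoidAlgebra.mapDomain_add, map_add, hf, hg]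
  | single a k =>
    rw [AddMonoidAlgebra.mapDomain_single, weightComponent_single, weightComponent_single]
    split_ifs
    · rw [AddMonoidAlgebra.mapDomain_single]
    · simp

theorem WeightGE.mapDomain {A B : Type*} {φ : A → B} {ω : B → ℝ} {c : ℝ}
    {f : AddMonoidAlgebra K A} (hf : WeightGE (fun a => ω (φ a)) c f) :
    WeightGE ω c (AddMonoidAlgebra.mapDomain φ f) := by
  classical
  intro b hb
  by_contra hlt
  have h1 := weightComponent_coeff ω (ω b) (AddMonoidAlgebra.mapDomain φ f) b
  rw [weightComponent_mapDomain, weightComponent_eq_zero hf (not_le.1 hlt), if_pos rfl,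
    AddMonoidAlgebra.mapDomain_zero] at h1
  exact hb h1.symm

end Points

/-! ### Assembling the tropical basis. -/

section Main

variable {K : Type*} [Field K] {r m : ℕ} {D : PolyhedralData r m} {L : TorusLine K m}
  {H : Finset D.dualMonoid}

/-- The ideal `J(L)` is generated by the toric ideal and lifts of the generators of `Ĩ(L)`. -/
theorem span_union_eq_idealJ (hH : AddSubmonoid.closure (H : Set D.dualMonoid) = ⊤)
    {A : Set (AddMonoidAlgebra K (Char r m))}
    (hA : Ideal.span {a : coneRing K D | coneRingIncl K D a ∈ A} = RingHom.ker (restriction D L))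
    {B E : Set (MvPolynomial H K)} (hB : Ideal.span B = toricIdeal K H)
    (hE : ∀ F ∈ E, ∃ a ∈ A, IsTermwiseLift H F a) (hE' : ∀ a ∈ A, ∃ F ∈ E, IsTermwiseLift H F a) :
    Ideal.span (B ∪ E) = idealJ L H := by
  rw [Ideal.span_union, hB]
  refine le_antisymm (sup_le ?_ (Ideal.span_le.2 ?_)) ?_
  · intro F hF
    change restriction D L (toricMap K H F) = 0
    rw [show toricMap K H F = 0 from hF, map_zero]
  · intro F hF
    obtain ⟨a, ha, hFa⟩ := hE F hF
    have : toricMap K H F ∈ RingHom.ker (restriction D L) := by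
      rw [← hA]
      refine Ideal.subset_span ?_
      change coneRingIncl K D (toricMap K H F) ∈ A
      rw [hFa.1]
      exact ha
    exact this
  · intro F hF
    have h1 : toricMap K H F ∈ RingHom.ker (restriction D L) := hF
    have h2 : RingHom.ker (restriction D L) ≤ Ideal.map (toricMap K H) (Ideal.span E) := by
      rw [← hA, Ideal.span_le]
      intro a ha
      obtain ⟨F', hF', hlift⟩ := hE' _ ha
      rw [← coneRingIncl_injective D hlift.1]
      exact Ideal.mem_map_of_mem _ (Ideal.subset_span hF')
    -- The map from `S` is surjective, so this preimage is the span of `E` plus the toric ideal.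
    have h3 : F ∈ Ideal.comap (toricMap K H) (Ideal.map (toricMap K H) (Ideal.span E)) := h2 h1
    rw [Ideal.comap_map_of_surjective _ (toricMap_surjective hH), sup_comm] at h3
    exact h3

/-- A common point of the tropical hypersurfaces of binomials is homogeneous on each of them. -/
theorem IsBinomial.weight_eq {ι : Type*} [Fintype ι] {f : MvPolynomial ι K} (hf : IsBinomial f)
    {w : ι → ℝ} (hw : w ∈ trop (hypersurface (toLaurent f))) {α β : ι →₀ ℕ}
    (hα : f.coeff α ≠ 0) (hβ : f.coeff β ≠ 0) :
    weightHom w (fun i => (α i : ℤ)) = weightHom w (fun i => (β i : ℤ)) := by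
  classical
  obtain ⟨α₀, β₀, a, b, rfl⟩ := hf
  set f := MvPolynomial.monomial α₀ a + MvPolynomial.monomial β₀ b with hfdef
  have hsupp : ∀ γ, f.coeff γ ≠ 0 → γ = α₀ ∨ γ = β₀ := by
    intro γ hγ
    by_contra! h
    apply hγ
    rw [hfdef, MvPolynomial.coeff_add, MvPolynomial.coeff_monomial, MvPolynomial.coeff_monomial,
      if_neg h.1.symm, if_neg h.2.symm, add_zero]
  have key : ∀ γ δ, f.coeff γ ≠ 0 → f.coeff δ ≠ 0 →
      weightHom w (fun i => (δ i : ℤ)) ≤ weightHom w (fun i => (γ i : ℤ)) := by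
    intro γ δ hγ hδ
    by_cases hγδ : γ = δ
    · rw [hγδ]
    -- With at most two monomials available, the competitor of `γ` can only be `δ`.
    obtain ⟨ε', h1, h2, h3⟩ := exists_weight_le_of_mem_trop hw
      (mem_torusIdeal_hypersurface _) (α := fun i => (γ i : ℤ)) (by rwa [toLaurent_coeff])
    obtain ⟨ε, rfl⟩ := exists_of_toLaurent_coeff_ne_zero h1
    rw [toLaurent_coeff] at h1
    have hne : ε ≠ γ := by rintro rfl; exact h2 rfl
    have : ε = δ := by
      rcases hsupp ε h1 with h | h <;> rcases hsupp γ hγ with h' | h' <;>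
        rcases hsupp δ hδ with h'' | h'' <;> simp_all
    rwa [← this]
  exact le_antisymm (key β α hβ hα) (key α β hα hβ)

theorem weightHom_single (ω : Char r m →+ ℝ) (v : Fin m → ℤ) :
    weightHom (fun j => ω (0, Pi.single j 1)) v = ω (0, v) := by
  classical
  have : ((0, v) : Char r m) = ∑ j, v j • ((0, Pi.single j 1) : Char r m) := by
    ext k <;> simp [Prod.fst_sum, Prod.snd_sum, Finset.sum_apply, Pi.single_apply]
  rw [this, map_sum, weightHom_apply, weight]
  refine Finset.sum_congr rfl fun j _ => ?_
  rw [map_zsmul, zsmul_eq_mul]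

theorem map_pair_eq (ω : Char r m →+ ℝ) (u : Fin r → ℤ) (v : Fin m → ℤ) :
    ω (u, v) = ω (u, 0) + weightHom (fun j => ω (0, Pi.single j 1)) v := by
  rw [weightHom_single, ← map_add, Prod.mk_add_mk, add_zero, zero_add]

/-- A weight on the lattice which restricts to a point of `trop L°` gives a point of the
tropicalization of `X(L)°`. -/
theorem mem_trop_varietyTorusPart [IsAlgClosed K]
    (hker : RingHom.ker (restriction D L) = tildeIdeal D L) {w : H → ℝ} {ω : Char r m →+ ℝ}
    (hω : ∀ n, ω (degreeHom H n) = weightHom w n)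
    (hw : (fun j => ω (0, Pi.single j 1)) ∈ trop L.torusPart) :
    w ∈ trop (varietyTorusPart L H) := by
  by_contra hcon
  obtain ⟨α, h, h1, h2, h3⟩ := notMem_trop_iff.1 hcon
  have hωw : (fun n => ω (degreeHom H n)) = weightHom w := funext hω
  have h4 : WeightGE ω (weightHom w α) (AddMonoidAlgebra.mapDomain (degreeHom H) h) :=
    WeightGE.mapDomain (by rwa [hωw])
  have h5 : weightComponent ω (weightHom w α) (AddMonoidAlgebra.mapDomain (degreeHom H) h) =
      AddMonoidAlgebra.single (degreeHom H α) 1 := by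
    rw [weightComponent_mapDomain, hωw, h3, AddMonoidAlgebra.mapDomain_single]
  have hwt : weightHom w α = ω ((degreeHom H α).1, 0) +
      weightHom (fun j => ω (0, Pi.single j 1)) (degreeHom H α).2 := by
    rw [← map_pair_eq, ← hω]
  -- The lowest component survives pushing forward. Slicing at the `M`-degree of `α` keeps it and
  -- shifts all weights by the constant `ω (u, 0)`, leaving a monomial initial form on `L°`.
  refine absurd hw (notMem_trop_iff.2 ⟨(degreeHom H α).2,
    slice (degreeHom H α).1 (AddMonoidAlgebra.mapDomain (degreeHom H) h),
    slice_mem_torusIdeal hker h1 _, fun v hv => ?_, ?_⟩)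
  · rw [slice_coeff] at hv
    have := h4 _ hv
    rw [hwt, map_pair_eq ω _ v] at this
    linarith
  · classical
    ext v
    rw [weightComponent_coeff, slice_coeff]
    have h6 := congrArg (fun F => F.coeff ((degreeHom H α).1, v)) h5
    simp only [weightComponent_coeff, hwt, map_pair_eq ω _ v, add_right_inj] at h6
    rw [h6, AddMonoidAlgebra.coeff_single, AddMonoidAlgebra.coeff_single, Finsupp.single_apply,
      Finsupp.single_apply]
    simp [Prod.ext_iff]

/-- If the lift of `(g z^v) χ^u` has no unique term of minimal weight, then neither has `g`. -/
theorem mem_trop_hypersurface_of_lift [IsAlgClosed K] {w : H → ℝ} {ω : Char r m →+ ℝ}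
    (hω : ∀ n, ω (degreeHom H n) = weightHom w n) {g : Laurent K (Fin m)} {c : Char r m}
    {F : MvPolynomial H K}
    (hF : IsTermwiseLift H F (twist c.1 (g * AddMonoidAlgebra.single c.2 1)))
    (hw : w ∈ trop (hypersurface (toLaurent F))) :
    (fun j => ω (0, Pi.single j 1)) ∈ trop (hypersurface g) := by
  have hcoeff : ∀ v, (twist c.1 (g * AddMonoidAlgebra.single c.2 1)).coeff (c.1, v) =
      g.coeff (v - c.2) := fun v => by
    rw [twist_coeff, AddMonoidAlgebra.coeff_mul_single_apply, mul_one, sub_eq_add_neg]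
  refine mem_trop_hypersurface fun v hv => ?_
  obtain ⟨α, hα, hαd⟩ := hF.exists_latticeDegree (d := (c.1, v + c.2))
    (by rwa [hcoeff, add_sub_cancel_right])
  obtain ⟨β', h1, h2, h3⟩ := exists_weight_le_of_mem_trop hw
    (mem_torusIdeal_hypersurface _) (α := fun i => (α i : ℤ)) (by rwa [toLaurent_coeff])
  obtain ⟨β, rfl⟩ := exists_of_toLaurent_coeff_ne_zero h1
  rw [toLaurent_coeff] at h1
  have hβ := hF.coeff_latticeDegree h1
  have hβ0 := hβ.trans_ne h1
  obtain ⟨v', hv'⟩ : ∃ v', (latticeDegree H β : Char r m) = (c.1, v' + c.2) := by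
    refine ⟨(latticeDegree H β : Char r m).2 - c.2, ?_⟩
    rw [sub_add_cancel, ← fst_eq_of_twist_coeff_ne_zero hβ0]
  refine ⟨v', ?_, ?_, ?_⟩
  · rwa [hv', hcoeff, add_sub_cancel_right] at hβ0
  · rintro rfl
    -- Here term-by-term matters: distinct monomials of the lift have distinct degrees, so the
    -- competing monomial gives a different term of `g`.
    have : α = β := hF.2 (MvPolynomial.mem_support_iff.2 hα) (MvPolynomial.mem_support_iff.2 h1)
      (Subtype.ext (hαd.trans hv'.symm))
    exact h2 (by rw [this])
  · rw [← hω, ← hω, degreeHom_natCast, degreeHom_natCast, hαd, hv', map_pair_eq ω c.1 (v' + _),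
      map_pair_eq ω c.1 (v + _), map_add, map_add] at h3
    linarith

end Main

end SemiCanonical

end

open SemiCanonical in
theorem mainTheorem9 {K : Type*} [Field K] [IsAlgClosed K] {r m : ℕ}
    (D : PolyhedralData r m) (L : TorusLine K m)
    (H : Finset D.dualMonoid) (hH : AddSubmonoid.closure (H : Set D.dualMonoid) = ⊤)
    (G : Set (Laurent K (Fin m))) (hG : IsTropicalBasis L.torusPart G)
    (hlin : ∀ g ∈ G, IsDehomogenizedLinear g)
    (Q : Set (Char r m)) (hQ : D.IsLatticeGenerators Q) :
    (∃ B : Set (MvPolynomial H K), (∀ f ∈ B, IsBinomial f) ∧ Ideal.span B = toricIdeal K H) ∧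
    (∀ a ∈ linearGenerators G Q, ∃ F : MvPolynomial H K, IsTermwiseLift H F a) ∧
    Ideal.span {a : coneRing K D | coneRingIncl K D a ∈ linearGenerators G Q} = tildeIdeal D L ∧
    ∀ B E : Set (MvPolynomial H K),
      (∀ f ∈ B, IsBinomial f) → Ideal.span B = toricIdeal K H →
      (∀ F ∈ E, ∃ a ∈ linearGenerators G Q, IsTermwiseLift H F a) →
      (∀ a ∈ linearGenerators G Q, ∃ F ∈ E, IsTermwiseLift H F a) →
      Ideal.span (B ∪ E) = idealJ L H ∧
      IsTropicalBasis (varietyTorusPart L H) (toLaurent '' (B ∪ E)) := by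
  have hspan := span_linearGenerators hG hlin hQ
  have hker := (tildeIdeal_eq_ker hG hlin hQ).symm
  refine ⟨exists_binomials hH, ?_, hspan, fun B E hBbin hB hE hE' => ?_⟩
  · rintro a ⟨g, hg, c, hc, rfl⟩
    obtain ⟨b, hb⟩ := exists_coneRingIncl_eq_twist (hlin g hg) (hQ.1 hc)
    rw [← hb]
    exact exists_isTermwiseLift hH b
  · have hJ := span_union_eq_idealJ hH (hspan.trans hker.symm) hB hE hE'
    have hsub : toLaurent '' (B ∪ E) ⊆ torusIdeal (varietyTorusPart L H) := by
      rintro _ ⟨F, hF, rfl⟩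
      refine mem_torusIdeal.2 fun x hx => evalTorus_toLaurent_eq_zero hx ?_
      rw [← hJ]
      exact Ideal.subset_span hF
    refine ⟨hJ, hsub, subset_antisymm ?_ fun w hw => ?_⟩
    · exact Set.subset_iInter₂ fun f hf => trop_mono (subset_hypersurface (hsub hf))
    · have hw' : ∀ F ∈ B ∪ E, w ∈ trop (hypersurface (toLaurent F)) := fun F hF =>
        Set.mem_iInter₂.1 hw _ ⟨F, hF, rfl⟩
      let W : (H →₀ ℕ) →+ ℝ :=
        { toFun := fun α => weightHom w fun h => (α h : ℤ)
          map_zero' := by simp [weightHom_apply, weight]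
          map_add' := fun α β => by
            rw [← map_add]
            congr 1 }
      -- The binomial half of the basis forces `w` to come from a weight on `M × ℤ^m`.
      obtain ⟨ω, hω⟩ := exists_extension w fun α β h => weight_eq_of_latticeDegree_eq hB W
        (fun f hf α β hα hβ => (hBbin f hf).weight_eq (hw' f (Or.inl hf)) hα hβ) h
      refine mem_trop_varietyTorusPart hker hω ?_
      rw [hG.2]
      refine Set.mem_iInter₂.2 fun g hg => ?_
      -- Properness guarantees that every `g` contributes at least one lift to `E`.
      obtain ⟨p, hp⟩ := D.latticeP_nonempty
      obtain ⟨q, hq, -⟩ := hQ.2 p hp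
      obtain ⟨F, hF, hlift⟩ := hE' _ ⟨g, hg, q, hq, rfl⟩
      exact mem_trop_hypersurface_of_lift hω hlift (hw' F (Or.inr hF))
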